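/- Let $\mathcal L u=\sum_{i,j=1}^n\partial_{x_i}\big(a_{ij}(x)\,\partial_{x_j}u\big)$ on $\mathbb R^n$, where the $a_{ij}=a_{ji}$ are smooth real functions on $\mathbb R^n$, the matrix $A(x)=(a_{ij}(x))$ is nonnegative definite and $\sum_i a_{ii}(x)>0$ for every $x$. Assume that $\mathcal L$ is hypoelliptic in $\mathbb R^n$ (for every open $U\subseteq\mathbb R^n$, every distribution $T$ on $U$ with $\mathcal LT\in C^\infty(U)$ belongs to $C^\infty(U)$), and that $\mathcal L$ has a fundamental solution $\Gamma\in C^\infty(\{(x,y)\in\mathbb R^n\times\mathbb R^n: x\ne y\},\mathbb R)$, i.e. $\int_{\mathbb R^n}\Gamma(x,y)\,\mathcal L\varphi(y)\,dy=-\varphi(x)$ for all $\varphi\in C_0^\infty(\mathbb R^n)$, $x\in\mathbb R^n$, such that (i) $\Gamma(x,y)=\Gamma(y,x)>0$ for all $x\neq y$; (ii) $\lim_{x\to y}\Gamma(x,y)=\infty$ for every $y$; (iii) $\lim_{x\to\infty}\sup_{y\in K}\Gamma(x,y)=0$ for every compact $K\subseteq\mathbb R^n$; (iv) $\Gamma(x,\cdot)\in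 L^1_{\rm loc}(\mathbb R^n)$ for every $x$. Fix $\alpha>-1$. For $x\in\mathbb R^n$ and $r>0$ let $\Omega_r(x)=\{y:\Gamma(x,y)>1/r\}$ (with $\Gamma(x,x)=\infty$), $$M_r(u)(x)=\frac{\alpha+1}{r^{\alpha+1}}\int_{\Omega_r(x)}u(y)\,\frac{\langle A(y)\nabla_y\Gamma(x,y),\nabla_y\Gamma(x,y)\rangle}{\Gamma(x,y)^{\alpha+2}}\,dy,$$ $$Q_r(x)=\frac{\alpha+1}{r^{\alpha+1}}\int_0^r\rho^\alpha\Big(\int_{\Omega_\rho(x)}\Big(\Gamma(x,y)-\frac1\rho\Big)dy\Big)d\rho .$$ Let $\mathcal A(\mathbb R^n,\mathcal L)$ be the set of continuous $u:\mathbb R^n\to\mathbb R$ for which $$\mathcal L_a u(x):=\lim_{r\to0^+}\frac{M_r(u)(x)-u(x)}{Q_r(x)}$$ exists in $\mathbb R$ for every $x\in\mathbb R^n$. **Theorem.** Let $f:\mathbb R^n\to\mathbb R$ be continuous with compact support and let $u_f(x)=\int_{\mathbb R^n}\Gamma(x,y)f(y)\,dy$. Then $u_f\in\mathcal A(\mathbb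 R^n,\mathcal L)$ and $\mathcal L_a u_f(x)=-f(x)$ for every $x\in\mathbb R^n$. (In particular, everything here is well defined: the integrals defining $u_f(x)$ and $M_r(u_f)(x)$ converge absolutely and $Q_r(x)>0$, for all $x\in\mathbb R^n$ and $r>0$.) -/

import Mathlib

open Set Filter Topology MeasureTheory TopologicalSpace
open scoped ContDiff Distributions

/-- `i`-th partial derivative of a real function on `ℝⁿ`. -/
noncomputable def pderiv {n : ℕ} (i : Fin n) (u : EuclideanSpace ℝ (Fin n) → ℝ)
    (x : EuclideanSpace ℝ (Fin n)) : ℝ :=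
  fderiv ℝ u x (EuclideanSpace.single i 1)

/-- The coefficient matrix of a second order operator `∑ᵢⱼ ∂ᵢ (aᵢⱼ ∂ⱼ ·)` on `ℝⁿ`: smooth,
symmetric nonnegative definite (`Matrix.PosSemidef` includes symmetry), of positive trace. -/
structure DivFormOperator (n : ℕ) where
  /-- the coefficients -/
  a : EuclideanSpace ℝ (Fin n) → Matrix (Fin n) (Fin n) ℝ
  smooth : ∀ i j, ContDiff ℝ ∞ (fun x => a x i j)
  posSemidef : ∀ x, (a x).PosSemidef
  trace_pos : ∀ x, 0 < (a x).trace

namespace DivFormOperator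

variable {n : ℕ} (L : DivFormOperator n)

/-- `L u = ∑ᵢ ∂ᵢ (∑ⱼ aᵢⱼ ∂ⱼ u)`, the classical pointwise action. -/
noncomputable def op (u : EuclideanSpace ℝ (Fin n) → ℝ) (x : EuclideanSpace ℝ (Fin n)) : ℝ :=
  ∑ i, pderiv i (fun z => ∑ j, L.a z i j * pderiv j u z) x

theorem contDiff_pderiv (i : Fin n) {u : EuclideanSpace ℝ (Fin n) → ℝ} (hu : ContDiff ℝ ∞ u) :
    ContDiff ℝ ∞ (pderiv i u) :=
  (hu.fderiv_right (m := ∞) (by simp)).clm_apply contDiff_const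

theorem tsupport_pderiv_subset (i : Fin n) (u : EuclideanSpace ℝ (Fin n) → ℝ) :
    tsupport (pderiv i u) ⊆ tsupport u := by
  refine (closure_mono ?_).trans (tsupport_fderiv_subset ℝ)
  intro x hx h
  apply hx
  change fderiv ℝ u x (EuclideanSpace.single i 1) = 0
  rw [h]
  rfl

theorem contDiff_op {u : EuclideanSpace ℝ (Fin n) → ℝ} (hu : ContDiff ℝ ∞ u) :
    ContDiff ℝ ∞ (L.op u) :=
  ContDiff.sum fun i _ => contDiff_pderiv i <| ContDiff.sum fun j _ =>
    (L.smooth i j).mul (contDiff_pderiv j hu)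

theorem tsupport_op_subset (u : EuclideanSpace ℝ (Fin n) → ℝ) :
    tsupport (L.op u) ⊆ tsupport u := by
  refine closure_minimal ?_ (isClosed_tsupport u)
  intro x hx
  obtain ⟨i, -, hi⟩ := Finset.exists_ne_zero_of_sum_ne_zero hx
  have h1 := tsupport_pderiv_subset i _ (subset_tsupport _ hi)
  refine closure_minimal ?_ (isClosed_tsupport u) h1
  intro y hy
  obtain ⟨j, -, hj⟩ := Finset.exists_ne_zero_of_sum_ne_zero hy
  exact tsupport_pderiv_subset j u (subset_tsupport _ (right_ne_zero_of_mul hj))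

/-- `L φ` as a test function, for a test function `φ`. -/
noncomputable def opTest {U : Opens (EuclideanSpace ℝ (Fin n))} (φ : 𝓓(U, ℝ)) : 𝓓(U, ℝ) where
  toFun := L.op φ
  contDiff' := L.contDiff_op φ.contDiff
  hasCompactSupport' :=
    φ.hasCompactSupport.of_isClosed_subset (isClosed_tsupport _) (L.tsupport_op_subset φ)
  tsupport_subset' := (L.tsupport_op_subset φ).trans φ.tsupport_subset

/-- `L` is hypoelliptic in `ℝⁿ`: for every open `U`, a distribution `T` on `U` for which `L T` is
(given by) a smooth function on `U` is itself (given by) a smooth function on `U`. As `L` is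
formally self-adjoint, the distribution `L T` is `φ ↦ T (L φ)`. -/
def IsHypoelliptic : Prop :=
  ∀ (U : Opens (EuclideanSpace ℝ (Fin n))) (T : 𝓓'(U, ℝ)) (g : EuclideanSpace ℝ (Fin n) → ℝ),
    ContDiffOn ℝ ∞ g U →
    (∀ φ : 𝓓(U, ℝ), T (L.opTest φ) = ∫ x in (U : Set (EuclideanSpace ℝ (Fin n))), g x * φ x) →
    ∃ h : EuclideanSpace ℝ (Fin n) → ℝ, ContDiffOn ℝ ∞ h U ∧
      ∀ φ : 𝓓(U, ℝ), T φ = ∫ x in (U : Set (EuclideanSpace ℝ (Fin n))), h x * φ x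

/-- `Γ` is a fundamental solution of `L`, smooth off the diagonal and positive, symmetric, with a
pole on the diagonal, vanishing at infinity and locally integrable. The values of `Γ` on the
diagonal are irrelevant. -/
structure IsFundamentalSolution
    (Γ : EuclideanSpace ℝ (Fin n) → EuclideanSpace ℝ (Fin n) → ℝ) : Prop where
  smooth : ContDiffOn ℝ ∞ (Function.uncurry Γ) {p | p.1 ≠ p.2}
  symm : ∀ x y, x ≠ y → Γ x y = Γ y x
  pos : ∀ x y, x ≠ y → 0 < Γ x y
  pole : ∀ y, Tendsto (fun x => Γ x y) (𝓝[≠] y) atTop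
  vanish : ∀ K : Set (EuclideanSpace ℝ (Fin n)), IsCompact K →
    Tendsto (fun x => ⨆ y : K, Γ x y) (cocompact (EuclideanSpace ℝ (Fin n))) (𝓝 0)
  locallyIntegrable : ∀ x, LocallyIntegrable (Γ x) volume
  fundamental : ∀ φ : EuclideanSpace ℝ (Fin n) → ℝ, ContDiff ℝ ∞ φ → HasCompactSupport φ →
    ∀ x, ∫ y, Γ x y * L.op φ y = -φ x

/-- The `L`-ball `Ω_r(x) = {y : Γ(x,y) > 1/r}`, with the convention `Γ(x,x) = ∞`. -/
def lBall (Γ : EuclideanSpace ℝ (Fin n) → EuclideanSpace ℝ (Fin n) → ℝ) (r : ℝ)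
    (x : EuclideanSpace ℝ (Fin n)) : Set (EuclideanSpace ℝ (Fin n)) :=
  {y | y = x ∨ 1 / r < Γ x y}

/-- `K(x,y) = ⟨A(y) ∇_y Γ(x,y), ∇_y Γ(x,y)⟩ / Γ(x,y)^(α+2)`. -/
noncomputable def kernel (Γ : EuclideanSpace ℝ (Fin n) → EuclideanSpace ℝ (Fin n) → ℝ) (α : ℝ)
    (x y : EuclideanSpace ℝ (Fin n)) : ℝ :=
  (∑ i, ∑ j, L.a y i j * pderiv j (Γ x) y * pderiv i (Γ x) y) / Γ x y ^ (α + 2)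

/-- The average operator `M_r`. -/
noncomputable def avgM (Γ : EuclideanSpace ℝ (Fin n) → EuclideanSpace ℝ (Fin n) → ℝ) (α r : ℝ)
    (u : EuclideanSpace ℝ (Fin n) → ℝ) (x : EuclideanSpace ℝ (Fin n)) : ℝ :=
  (α + 1) / r ^ (α + 1) * ∫ y in lBall Γ r x, u y * L.kernel Γ α x y

/-- The average operator `N_r`. -/
noncomputable def avgN (Γ : EuclideanSpace ℝ (Fin n) → EuclideanSpace ℝ (Fin n) → ℝ) (α r : ℝ)
    (w : EuclideanSpace ℝ (Fin n) → ℝ) (x : EuclideanSpace ℝ (Fin n)) : ℝ :=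
  (α + 1) / r ^ (α + 1) *
    ∫ ρ in (0 : ℝ)..r, ρ ^ α * ∫ y in lBall Γ ρ x, (Γ x y - 1 / ρ) * w y

/-- `Q_r = N_r(1)`. -/
noncomputable def avgQ (Γ : EuclideanSpace ℝ (Fin n) → EuclideanSpace ℝ (Fin n) → ℝ) (α r : ℝ)
    (x : EuclideanSpace ℝ (Fin n)) : ℝ :=
  avgN Γ α r (fun _ => 1) x

/-- The quotient `(M_r(u)(x) - u(x)) / Q_r(x)`. -/
noncomputable def asympQuotient (Γ : EuclideanSpace ℝ (Fin n) → EuclideanSpace ℝ (Fin n) → ℝ)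
    (α : ℝ) (u : EuclideanSpace ℝ (Fin n) → ℝ) (x : EuclideanSpace ℝ (Fin n)) (r : ℝ) : ℝ :=
  (L.avgM Γ α r u x - u x) / avgQ Γ α r x

/-- The class `𝒜(Ω, L)`: continuous `u` whose quotients have a real limit as `r → 0⁺` at every
point of `Ω`. -/
def asympClass (Γ : EuclideanSpace ℝ (Fin n) → EuclideanSpace ℝ (Fin n) → ℝ) (α : ℝ)
    (Ω : Set (EuclideanSpace ℝ (Fin n))) : Set (EuclideanSpace ℝ (Fin n) → ℝ) :=
  {u | ContinuousOn u Ω ∧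
    ∀ x ∈ Ω, ∃ l : ℝ, Tendsto (L.asympQuotient Γ α u x) (𝓝[>] 0) (𝓝 l)}

/-- The asymptotic average operator `L_a u(x) = lim_{r → 0⁺} (M_r(u)(x) - u(x)) / Q_r(x)`. -/
noncomputable def asympOp (Γ : EuclideanSpace ℝ (Fin n) → EuclideanSpace ℝ (Fin n) → ℝ) (α : ℝ)
    (u : EuclideanSpace ℝ (Fin n) → ℝ) (x : EuclideanSpace ℝ (Fin n)) : ℝ :=
  limUnder (𝓝[>] (0 : ℝ)) (L.asympQuotient Γ α u x)

end DivFormOperator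

/-- The potential `u_f(x) = ∫ Γ(x,y) f(y) dy`. -/
noncomputable def potential {n : ℕ}
    (Γ : EuclideanSpace ℝ (Fin n) → EuclideanSpace ℝ (Fin n) → ℝ)
    (f : EuclideanSpace ℝ (Fin n) → ℝ) (x : EuclideanSpace ℝ (Fin n)) : ℝ :=
  ∫ y, Γ x y * f y

/-!
Write `G = Γ(x,·)` and `e = ⟨A ∇G, ∇G⟩`. The theorem follows from the identity
`M_r(u_f)(x) - u_f(x) = -N_r(f)(x)`, valid for every `r > 0` (`avgM_potential_sub`): as `r → 0⁺` the
`L`-balls shrink to `x`, so that `N_r(f)(x) / N_r(1)(x) → f(x)` (`abs_avgN_sub_le`).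

By Fubini the identity reduces to computing the average over `Ω_r(x)` of the single function
`Γ(·,z)`, `z ≠ x`. No surface integrals, regular values or coarea formula are needed for this: if
`θ` is smooth with compact support in `(0,∞)` and `∫ θ = 0`, and `h'' = θ` with `h = 0` near `0`,
then `h ∘ G` is constant near the pole and zero near infinity, hence a test function, and
`L (h ∘ G) = θ(G) e` because `L G = 0` off `x`. Integrating it against `1`, `Γ(x,·)` and `Γ(z,·)`
determines the images under `G` of the measures `e dy` and `Γ(z,·) e dy`: they are `ds`
(`integral_levelDensity`) and `min (Γ(x,z)) s ds` (`integral_mul_levelDensity`) on `(0,∞)`. Monotone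
approximation of `s^(-α-2)` on `(1/r,∞)` by such `θ` and the substitution `s = 1/ρ` give
`∫_{Ω_r(x)} Γ(·,z) K(x,·) = ∫₀^r ρ^α min (Γ(x,z)) (1/ρ) dρ` (`setIntegral_mul_kernel`). The
difference `min g (1/ρ) = g - (g - 1/ρ)⁺` is where `N_r` comes from.

The continuity of `u_f` (`continuous_potential`) uses the positivity of the trace: it yields, near
any `x₀`, a test function `φ` with `L φ > 0` on a ball about `x₀`. Since `∫ Γ(x,y) L φ(y) dy = -φ(x)`
is continuous in `x`, Scheffé's lemma shows that `x ↦ Γ(x,·)` is continuous at `x₀` into `L¹` of the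
ball.
-/

/-! ### Partial derivatives and Green's formula -/

section Calculus

variable {n : ℕ}

theorem Filter.EventuallyEq.pderiv_eq {u v : EuclideanSpace ℝ (Fin n) → ℝ}
    {x : EuclideanSpace ℝ (Fin n)} (h : u =ᶠ[𝓝 x] v) (i : Fin n) :
    pderiv i u x = pderiv i v x := by
  unfold pderiv
  rw [h.fderiv_eq]

theorem Filter.EventuallyEq.pderiv {u v : EuclideanSpace ℝ (Fin n) → ℝ}
    {x : EuclideanSpace ℝ (Fin n)} (h : u =ᶠ[𝓝 x] v) (i : Fin n) :
    pderiv i u =ᶠ[𝓝 x] pderiv i v :=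
  h.eventuallyEq_nhds.mono fun _ hy => hy.pderiv_eq i

theorem contDiffOn_pderiv {U : Set (EuclideanSpace ℝ (Fin n))} (hU : IsOpen U)
    {u : EuclideanSpace ℝ (Fin n) → ℝ} (hu : ContDiffOn ℝ ∞ u U) (i : Fin n) :
    ContDiffOn ℝ ∞ (pderiv i u) U :=
  (hu.fderiv_of_isOpen (m := ∞) hU (by simp)).clm_apply contDiffOn_const

theorem pderiv_mul {u v : EuclideanSpace ℝ (Fin n) → ℝ} {x : EuclideanSpace ℝ (Fin n)}
    (hu : DifferentiableAt ℝ u x) (hv : DifferentiableAt ℝ v x) (i : Fin n) :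
    pderiv i (fun z => u z * v z) x = pderiv i u x * v x + u x * pderiv i v x := by
  unfold pderiv
  rw [fderiv_fun_mul hu hv]
  simp
  ring

theorem pderiv_comp {h : ℝ → ℝ} {u : EuclideanSpace ℝ (Fin n) → ℝ}
    {x : EuclideanSpace ℝ (Fin n)} (hh : DifferentiableAt ℝ h (u x))
    (hu : DifferentiableAt ℝ u x) (i : Fin n) :
    pderiv i (fun z => h (u z)) x = deriv h (u x) * pderiv i u x := by
  unfold pderiv
  have := (hh.hasDerivAt.comp_hasFDerivAt x hu.hasFDerivAt).fderiv
  rw [show (fun z => h (u z)) = h ∘ u from rfl, this]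
  simp

/-- A function continuous on an open set times a continuous function compactly supported in
that set is continuous. -/
theorem ContinuousOn.continuous_mul_of_tsupport_subset {X : Type*} [TopologicalSpace X]
    {U : Set X} (hU : IsOpen U) {f g : X → ℝ}
    (hf : ContinuousOn f U) (hg : Continuous g) (hgU : tsupport g ⊆ U) :
    Continuous (fun x => f x * g x) :=
  (hf.mul hg.continuousOn).continuous_of_tsupport_subset hU
    ((tsupport_mul_subset_right).trans hgU)

theorem ContinuousOn.integrable_mul_of_tsupport_subset {U : Set (EuclideanSpace ℝ (Fin n))}
    (hU : IsOpen U) {f g : EuclideanSpace ℝ (Fin n) → ℝ}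
    (hf : ContinuousOn f U) (hg : Continuous g) (hgc : HasCompactSupport g)
    (hgU : tsupport g ⊆ U) : Integrable (fun x => f x * g x) :=
  (hf.continuous_mul_of_tsupport_subset hU hg hgU).integrable_of_hasCompactSupport hgc.mul_left

/-- Integration by parts on an open set, one factor being compactly supported there. -/
theorem integral_mul_pderiv {U : Set (EuclideanSpace ℝ (Fin n))} (hU : IsOpen U)
    {u v : EuclideanSpace ℝ (Fin n) → ℝ} (hu : ContDiffOn ℝ ∞ u U) (hv : ContDiff ℝ ∞ v)
    (hvc : HasCompactSupport v) (hvU : tsupport v ⊆ U) (i : Fin n) :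
    ∫ x, u x * pderiv i v x = -∫ x, pderiv i u x * v x := by
  exact integral_mul_fderiv_eq_neg_fderiv_mul_of_integrable
    ((contDiffOn_pderiv hU hu i).continuousOn.integrable_mul_of_tsupport_subset hU
      hv.continuous hvc hvU)
    (hu.continuousOn.integrable_mul_of_tsupport_subset hU
      (DivFormOperator.contDiff_pderiv i hv).continuous
      (hvc.of_isClosed_subset (isClosed_tsupport _) (DivFormOperator.tsupport_pderiv_subset i v))
      ((DivFormOperator.tsupport_pderiv_subset i v).trans hvU))
    (hu.continuousOn.integrable_mul_of_tsupport_subset hU hv.continuous hvc hvU)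
    (fun x hx => ((hu x (hvU hx)).contDiffAt (hU.mem_nhds (hvU hx))).differentiableAt (by simp))
    (fun x _ => hv.contDiffAt.differentiableAt (by simp))

end Calculus

namespace DivFormOperator

variable {n : ℕ} (L : DivFormOperator n)

/-- The `i`-th component of the vector field `A ∇u`. -/
noncomputable def flux (u : EuclideanSpace ℝ (Fin n) → ℝ) (i : Fin n)
    (x : EuclideanSpace ℝ (Fin n)) : ℝ :=
  ∑ j, L.a x i j * pderiv j u x

/-- The energy density `⟨A ∇u, ∇u⟩`. -/
noncomputable def energy (u : EuclideanSpace ℝ (Fin n) → ℝ)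
    (x : EuclideanSpace ℝ (Fin n)) : ℝ :=
  ∑ i, ∑ j, L.a x i j * pderiv j u x * pderiv i u x

theorem op_eq_sum_flux (u : EuclideanSpace ℝ (Fin n) → ℝ) (x : EuclideanSpace ℝ (Fin n)) :
    L.op u x = ∑ i, pderiv i (L.flux u i) x := rfl

theorem energy_eq_sum_flux (u : EuclideanSpace ℝ (Fin n) → ℝ) (x : EuclideanSpace ℝ (Fin n)) :
    L.energy u x = ∑ i, L.flux u i x * pderiv i u x := by
  simp only [energy, flux, Finset.sum_mul]

theorem energy_nonneg (u : EuclideanSpace ℝ (Fin n) → ℝ) (x : EuclideanSpace ℝ (Fin n)) :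
    0 ≤ L.energy u x := by
  have h := (L.posSemidef x).dotProduct_mulVec_nonneg (fun i => pderiv i u x)
  refine h.trans_eq ?_
  simp only [dotProduct, Matrix.mulVec, energy, Finset.mul_sum, star_trivial]
  exact Finset.sum_congr rfl fun i _ => Finset.sum_congr rfl fun j _ => by ring

theorem a_symm (x : EuclideanSpace ℝ (Fin n)) (i j : Fin n) : L.a x i j = L.a x j i := by
  have h := (L.posSemidef x).isHermitian.apply i j
  simpa using h.symm

theorem op_congr {u v : EuclideanSpace ℝ (Fin n) → ℝ} {x : EuclideanSpace ℝ (Fin n)}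
    (h : u =ᶠ[𝓝 x] v) : L.op u x = L.op v x := by
  simp only [op_eq_sum_flux]
  refine Finset.sum_congr rfl fun i _ => Filter.EventuallyEq.pderiv_eq ?_ i
  have h' : ∀ᶠ y in 𝓝 x, ∀ j, pderiv j u y = pderiv j v y := by
    rw [eventually_all]
    exact fun j => h.pderiv j
  filter_upwards [h'] with y hy
  simp only [flux, hy]

theorem contDiffOn_flux {U : Set (EuclideanSpace ℝ (Fin n))} (hU : IsOpen U)
    {u : EuclideanSpace ℝ (Fin n) → ℝ} (hu : ContDiffOn ℝ ∞ u U) (i : Fin n) :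
    ContDiffOn ℝ ∞ (L.flux u i) U :=
  ContDiffOn.sum fun j _ => (L.smooth i j).contDiffOn.mul (contDiffOn_pderiv hU hu j)

theorem contDiffOn_op {U : Set (EuclideanSpace ℝ (Fin n))} (hU : IsOpen U)
    {u : EuclideanSpace ℝ (Fin n) → ℝ} (hu : ContDiffOn ℝ ∞ u U) :
    ContDiffOn ℝ ∞ (L.op u) U :=
  ContDiffOn.sum fun i _ => contDiffOn_pderiv hU (L.contDiffOn_flux hU hu i) i

theorem continuousOn_energy {U : Set (EuclideanSpace ℝ (Fin n))} (hU : IsOpen U)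
    {u : EuclideanSpace ℝ (Fin n) → ℝ} (hu : ContDiffOn ℝ ∞ u U) :
    ContinuousOn (L.energy u) U :=
  continuousOn_finsetSum _ fun i _ => continuousOn_finsetSum _ fun j _ =>
    ((L.smooth i j).continuous.continuousOn.mul (contDiffOn_pderiv hU hu j).continuousOn).mul
      (contDiffOn_pderiv hU hu i).continuousOn

theorem tsupport_flux_subset (u : EuclideanSpace ℝ (Fin n) → ℝ) (i : Fin n) :
    tsupport (L.flux u i) ⊆ tsupport u := by
  refine closure_minimal (fun y hy => ?_) (isClosed_tsupport u)
  obtain ⟨j, -, hj⟩ := Finset.exists_ne_zero_of_sum_ne_zero hy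
  exact tsupport_pderiv_subset j u (subset_tsupport _ (right_ne_zero_of_mul hj))

/-- Green's formula for a smooth function on an open set and a test function in that set. -/
theorem integral_mul_op_comm {U : Set (EuclideanSpace ℝ (Fin n))} (hU : IsOpen U)
    {u v : EuclideanSpace ℝ (Fin n) → ℝ} (hu : ContDiffOn ℝ ∞ u U) (hv : ContDiff ℝ ∞ v)
    (hvc : HasCompactSupport v) (hvU : tsupport v ⊆ U) :
    ∫ x, u x * L.op v x = ∫ x, L.op u x * v x := by
  have hF : ∀ i, ContDiff ℝ ∞ (L.flux v i) := fun i =>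
    contDiffOn_univ.1 (L.contDiffOn_flux isOpen_univ hv.contDiffOn i)
  have hFs : ∀ i, tsupport (L.flux v i) ⊆ U := fun i => (L.tsupport_flux_subset v i).trans hvU
  have hFc : ∀ i, HasCompactSupport (L.flux v i) := fun i =>
    hvc.of_isClosed_subset (isClosed_tsupport _) (L.tsupport_flux_subset v i)
  have hcs : ∀ {w : EuclideanSpace ℝ (Fin n) → ℝ}, HasCompactSupport w → ∀ i,
      HasCompactSupport (pderiv i w) := fun hw i =>
    hw.of_isClosed_subset (isClosed_tsupport _) (tsupport_pderiv_subset i _)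
  have hG := fun i => L.contDiffOn_flux hU hu i
  calc ∫ x, u x * L.op v x = ∫ x, ∑ i, u x * pderiv i (L.flux v i) x := by
        simp only [op_eq_sum_flux, Finset.mul_sum]
    _ = ∑ i, ∫ x, u x * pderiv i (L.flux v i) x :=
        integral_finsetSum _ fun i _ => hu.continuousOn.integrable_mul_of_tsupport_subset hU
          (contDiff_pderiv i (hF i)).continuous (hcs (hFc i) i)
          ((tsupport_pderiv_subset i _).trans (hFs i))
    _ = ∑ i, -∫ x, pderiv i u x * L.flux v i x :=
        Finset.sum_congr rfl fun i _ => integral_mul_pderiv hU hu (hF i) (hFc i) (hFs i) i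
    _ = -∫ x, ∑ i, pderiv i u x * L.flux v i x := by
        rw [Finset.sum_neg_distrib, integral_finsetSum]
        exact fun i _ => (contDiffOn_pderiv hU hu i).continuousOn.integrable_mul_of_tsupport_subset
          hU (hF i).continuous (hFc i) (hFs i)
    _ = -∫ x, ∑ i, L.flux u i x * pderiv i v x := by
        congr 2
        ext x
        simp only [flux, Finset.mul_sum, Finset.sum_mul]
        rw [Finset.sum_comm]
        refine Finset.sum_congr rfl fun i _ => Finset.sum_congr rfl fun j _ => ?_
        rw [L.a_symm x j i]
        ring
    _ = ∑ i, -∫ x, L.flux u i x * pderiv i v x := by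
        rw [Finset.sum_neg_distrib, integral_finsetSum]
        exact fun i _ => (hG i).continuousOn.integrable_mul_of_tsupport_subset hU
          (contDiff_pderiv i hv).continuous (hcs hvc i) ((tsupport_pderiv_subset i v).trans hvU)
    _ = ∑ i, ∫ x, pderiv i (L.flux u i) x * v x := by
        refine Finset.sum_congr rfl fun i _ => ?_
        rw [integral_mul_pderiv hU (hG i) hv hvc hvU i, neg_neg]
    _ = ∫ x, ∑ i, pderiv i (L.flux u i) x * v x := by
        rw [integral_finsetSum]
        exact fun i _ => (contDiffOn_pderiv hU (hG i)
          i).continuousOn.integrable_mul_of_tsupport_subset hU hv.continuous hvc hvU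
    _ = ∫ x, L.op u x * v x := by
        simp only [op_eq_sum_flux, Finset.sum_mul]

theorem op_const (c : ℝ) (x : EuclideanSpace ℝ (Fin n)) : L.op (fun _ => c) x = 0 := by
  have h : ∀ (i : Fin n) (d : ℝ) y, pderiv i (fun _ => d) y = 0 := fun i d y => by
    simp [pderiv]
  simp [op, h]

/-- `∫ L v = 0` for a test function `v`. -/
theorem integral_op_eq_zero {v : EuclideanSpace ℝ (Fin n) → ℝ} (hv : ContDiff ℝ ∞ v)
    (hvc : HasCompactSupport v) : ∫ x, L.op v x = 0 := by
  have h := L.integral_mul_op_comm isOpen_univ (contDiffOn_const (c := (1 : ℝ))) hv hvc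
    (subset_univ _)
  simpa [op_const] using h

/-- The chain rule `L (h ∘ u) = h''(u) ⟨A ∇u, ∇u⟩ + h'(u) L u`. -/
theorem op_comp {U : Set (EuclideanSpace ℝ (Fin n))} (hU : IsOpen U)
    {u : EuclideanSpace ℝ (Fin n) → ℝ} (hu : ContDiffOn ℝ ∞ u U) {h : ℝ → ℝ}
    (hh : ContDiff ℝ ∞ h) {x : EuclideanSpace ℝ (Fin n)} (hx : x ∈ U) :
    L.op (fun z => h (u z)) x =
      deriv (deriv h) (u x) * L.energy u x + deriv h (u x) * L.op u x := by
  have hd : ∀ {w : EuclideanSpace ℝ (Fin n) → ℝ}, ContDiffOn ℝ ∞ w U → ∀ y ∈ U,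
      DifferentiableAt ℝ w y := fun hw y hy =>
    ((hw y hy).contDiffAt (hU.mem_nhds hy)).differentiableAt (by simp)
  have hh' : ContDiff ℝ ∞ (deriv h) := (contDiff_infty_iff_deriv.1 hh).2
  have hflux : ∀ i, L.flux (fun z => h (u z)) i =ᶠ[𝓝 x]
      fun z => deriv h (u z) * L.flux u i z := by
    intro i
    filter_upwards [hU.mem_nhds hx] with y hy
    simp only [flux, Finset.mul_sum]
    refine Finset.sum_congr rfl fun j _ => ?_
    rw [pderiv_comp (hh.differentiable (by simp) _) (hd hu y hy)]
    ring
  simp only [op_eq_sum_flux, energy_eq_sum_flux, Finset.mul_sum, ← Finset.sum_add_distrib]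
  refine Finset.sum_congr rfl fun i _ => ?_
  rw [(hflux i).pderiv_eq i, pderiv_mul (u := fun z => deriv h (u z))
    (hd (hh'.comp_contDiffOn hu) x hx) (hd (L.contDiffOn_flux hU hu i) x hx),
    pderiv_comp (hh'.differentiable (by simp) _) (hd hu x hx)]
  ring

/-- Positivity of the trace provides a test function with `L φ > 0` at a given point: a cutoff of
`x ↦ ‖x - x₀‖²`. -/
theorem exists_op_pos (x₀ : EuclideanSpace ℝ (Fin n)) :
    ∃ φ : EuclideanSpace ℝ (Fin n) → ℝ, ContDiff ℝ ∞ φ ∧ HasCompactSupport φ ∧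
      0 < L.op φ x₀ := by
  let η : ContDiffBump x₀ := ⟨1, 2, by norm_num, by norm_num⟩
  let q : EuclideanSpace ℝ (Fin n) → ℝ := fun x => ‖x - x₀‖ ^ 2
  have hq : ContDiff ℝ ∞ q := (contDiff_id.sub contDiff_const).norm_sq ℝ
  have hqd : ∀ i x, pderiv i q x = 2 * (x i - x₀ i) := by
    intro i x
    have h1 : HasFDerivAt (fun x => x - x₀) (ContinuousLinearMap.id ℝ _) x :=
      (hasFDerivAt_id x).sub_const x₀
    have h2 := h1.norm_sq.fderiv
    simp only [pderiv, q]
    rw [h2]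
    simp [EuclideanSpace.inner_single_right]
  have hpc : ∀ i j : Fin n, pderiv i (fun x => 2 * (x j - x₀ j)) x₀ = if i = j then 2 else 0 := by
    intro i j
    have h1 : HasFDerivAt (fun x : EuclideanSpace ℝ (Fin n) => x j)
      (EuclideanSpace.proj j : EuclideanSpace ℝ (Fin n) →L[ℝ] ℝ) x₀ :=
      (EuclideanSpace.proj j : EuclideanSpace ℝ (Fin n) →L[ℝ] ℝ).hasFDerivAt
    have h2 := ((h1.sub_const (x₀ j)).const_mul 2).fderiv
    unfold pderiv
    rw [h2]
    simp [eq_comm]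
  refine ⟨fun x => η x * q x, η.contDiff.mul hq, η.hasCompactSupport.mul_right, ?_⟩
  have heq : (fun x => η x * q x) =ᶠ[𝓝 x₀] q := by
    filter_upwards [η.eventuallyEq_one] with x hx
    rw [hx, Pi.one_apply, one_mul]
  rw [L.op_congr heq]
  have key : L.op q x₀ = 2 * (L.a x₀).trace := by
    simp only [op_eq_sum_flux, Matrix.trace, Finset.mul_sum, Matrix.diag]
    refine Finset.sum_congr rfl fun i _ => ?_
    have h1 : L.flux q i = fun z => ∑ j, L.a z i j * (2 * (z j - x₀ j)) := by
      ext z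
      simp only [flux, hqd]
    have hda : ∀ j, DifferentiableAt ℝ (fun z => L.a z i j) x₀ := fun j =>
      (L.smooth i j).differentiable (by simp) x₀
    have hdc : ∀ j, DifferentiableAt ℝ
        (fun z : EuclideanSpace ℝ (Fin n) => 2 * (z j - x₀ j)) x₀ := by
      intro j
      fun_prop
    rw [h1]
    have h2 : pderiv i (fun z => ∑ j, L.a z i j * (2 * (z j - x₀ j))) x₀ =
        ∑ j, pderiv i (fun z => L.a z i j * (2 * (z j - x₀ j))) x₀ := by
      unfold pderiv
      rw [fderiv_fun_sum (fun j _ => (hda j).fun_mul (hdc j))]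
      simp
    rw [h2]
    have h3 : ∀ j, pderiv i (fun z => L.a z i j * (2 * (z j - x₀ j))) x₀ =
        if i = j then L.a x₀ i j * 2 else 0 := by
      intro j
      rw [pderiv_mul (hda j) (hdc j), hpc]
      simp
    simp [h3, mul_comm]
  rw [key]
  exact mul_pos two_pos (L.trace_pos x₀)

end DivFormOperator

/-! ### Elementary properties of the fundamental solution -/

/-- Scheffé's lemma for nonnegative functions along a countably generated filter. -/
theorem tendsto_integral_abs_sub_of_tendsto_integral {X ι : Type*} [MeasurableSpace X]
    {μ : Measure X} {l : Filter ι} [l.IsCountablyGenerated] {F : ι → X → ℝ} {G : X → ℝ}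
    (hF : ∀ i, Integrable (F i) μ) (hG : Integrable G μ) (hF0 : ∀ i, 0 ≤ᵐ[μ] F i)
    (hlim : ∀ᵐ y ∂μ, Tendsto (fun i => F i y) l (𝓝 (G y)))
    (hint : Tendsto (fun i => ∫ y, F i y ∂μ) l (𝓝 (∫ y, G y ∂μ))) :
    Tendsto (fun i => ∫ y, |F i y - G y| ∂μ) l (𝓝 0) := by
  have hpos : Tendsto (fun i => ∫ y, max (G y - F i y) 0 ∂μ) l (𝓝 (∫ _, (0 : ℝ) ∂μ)) := by
    refine tendsto_integral_filter_of_dominated_convergence (fun y => |G y|)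
      (Eventually.of_forall fun i => ((hG.sub (hF i)).pos_part).aestronglyMeasurable)
      (Eventually.of_forall fun i => ?_) hG.abs ?_
    · filter_upwards [hF0 i] with y hy
      rw [Real.norm_eq_abs, abs_of_nonneg (le_max_right _ _)]
      refine max_le ?_ (abs_nonneg _)
      have : 0 ≤ F i y := hy
      linarith [le_abs_self (G y)]
    · filter_upwards [hlim] with y hy
      have h := (tendsto_const_nhds (x := G y)).sub hy
      simpa using h.max (tendsto_const_nhds (x := (0 : ℝ)))
  have heq : ∀ i, ∫ y, |F i y - G y| ∂μ =
      (∫ y, F i y ∂μ) - (∫ y, G y ∂μ) + 2 * ∫ y, max (G y - F i y) 0 ∂μ := by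
    intro i
    rw [← integral_sub (hF i) hG, ← integral_const_mul,
      ← integral_add (f := fun y => F i y - G y) ((hF i).sub hG)]
    · refine integral_congr_ae (Eventually.of_forall fun y => ?_)
      simp only
      rcases le_total (F i y) (G y) with h | h
      · rw [abs_of_nonpos (by linarith), max_eq_left (by linarith)]
        ring
      · rw [abs_of_nonneg (by linarith), max_eq_right (by linarith)]
        ring
    · exact ((hG.sub (hF i)).pos_part).const_mul 2
  simp only [heq]
  simpa using (hint.sub_const (∫ y, G y ∂μ)).add (hpos.const_mul 2)

namespace DivFormOperator

variable {n : ℕ} {L : DivFormOperator n}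
  {Γ : EuclideanSpace ℝ (Fin n) → EuclideanSpace ℝ (Fin n) → ℝ}

/-- The trace condition excludes dimension zero, so that points are null sets. -/
theorem nullSingletonClass (L : DivFormOperator n) :
    NullSingletonClass (volume : Measure (EuclideanSpace ℝ (Fin n))) := by
  have : Nonempty (Fin n) := by
    by_contra h
    rw [not_nonempty_iff] at h
    have := L.trace_pos 0
    simp [Matrix.trace] at this
  infer_instance

theorem ae_ne (L : DivFormOperator n) (x : EuclideanSpace ℝ (Fin n)) :
    ∀ᵐ y, y ≠ x := by
  have := L.nullSingletonClass
  exact ae_iff.2 (by simp)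

namespace IsFundamentalSolution

theorem isOpen_offDiag : IsOpen {p : EuclideanSpace ℝ (Fin n) × EuclideanSpace ℝ (Fin n) |
    p.1 ≠ p.2} := isOpen_ne_fun continuous_fst continuous_snd

theorem contDiffOn (hΓ : L.IsFundamentalSolution Γ) (x : EuclideanSpace ℝ (Fin n)) :
    ContDiffOn ℝ ∞ (Γ x) {x}ᶜ :=
  hΓ.smooth.comp (contDiff_const.prodMk contDiff_id).contDiffOn fun _ hy h => hy h.symm

theorem continuousAt (hΓ : L.IsFundamentalSolution Γ) {x y : EuclideanSpace ℝ (Fin n)}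
    (h : x ≠ y) : ContinuousAt (Function.uncurry Γ) (x, y) :=
  hΓ.smooth.continuousOn.continuousAt (isOpen_offDiag.mem_nhds h)

theorem contDiffAt (hΓ : L.IsFundamentalSolution Γ) {x y : EuclideanSpace ℝ (Fin n)}
    (h : y ≠ x) : ContDiffAt ℝ ∞ (Γ x) y :=
  (hΓ.contDiffOn x y h).contDiffAt (isOpen_compl_singleton.mem_nhds h)

theorem tendsto_atTop (hΓ : L.IsFundamentalSolution Γ) (x : EuclideanSpace ℝ (Fin n)) :
    Tendsto (Γ x) (𝓝[≠] x) atTop :=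
  (hΓ.pole x).congr' (eventually_mem_nhdsWithin.mono fun _ hy => hΓ.symm _ _ hy)

theorem tendsto_cocompact (hΓ : L.IsFundamentalSolution Γ) (x : EuclideanSpace ℝ (Fin n)) :
    Tendsto (Γ x) (cocompact _) (𝓝 0) := by
  have h := hΓ.vanish {x} isCompact_singleton
  refine h.congr' ?_
  filter_upwards [(isCompact_singleton (x := x)).compl_mem_cocompact] with y hy
  rw [ciSup_unique]
  exact hΓ.symm _ _ hy

theorem integrable_mul (hΓ : L.IsFundamentalSolution Γ) (x : EuclideanSpace ℝ (Fin n))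
    {f : EuclideanSpace ℝ (Fin n) → ℝ} (hf : Continuous f) (hfc : HasCompactSupport f) :
    Integrable (fun y => Γ x y * f y) :=
  (hΓ.locallyIntegrable x).integrable_smul_right_of_hasCompactSupport hf hfc

/-- `Γ x` solves `L u = 0` off `x`. -/
theorem op_eq_zero (hΓ : L.IsFundamentalSolution Γ) {x y : EuclideanSpace ℝ (Fin n)}
    (h : y ≠ x) : L.op (Γ x) y = 0 := by
  have hc := (L.contDiffOn_op isOpen_compl_singleton (hΓ.contDiffOn x)).continuousOn
  have hae : ∀ᵐ z, z ∈ ({x}ᶜ : Set (EuclideanSpace ℝ (Fin n))) → L.op (Γ x) z = 0 := by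
    refine isOpen_compl_singleton.ae_eq_zero_of_integral_contDiff_smul_eq_zero
      (hc.locallyIntegrableOn (measurableSet_singleton x).compl) fun g hg hgc hgs => ?_
    have h1 := L.integral_mul_op_comm isOpen_compl_singleton (hΓ.contDiffOn x) hg hgc hgs
    rw [hΓ.fundamental g hg hgc x, image_eq_zero_of_notMem_tsupport (fun hx => hgs hx rfl),
      neg_zero] at h1
    simpa [mul_comm] using h1.symm
  have heq := Measure.eqOn_of_ae_eq
    ((ae_restrict_iff' (measurableSet_singleton x).compl).2 hae) hc
    (continuousOn_const (c := (0 : ℝ)))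
    (by rw [isOpen_compl_singleton.interior_eq]; exact subset_closure)
  exact heq h

/-- The part of a potential produced away from `x₀` is continuous at `x₀`. -/
theorem tendsto_setIntegral_compl_closedBall (hΓ : L.IsFundamentalSolution Γ)
    (x₀ : EuclideanSpace ℝ (Fin n)) {δ : ℝ} (hδ : 0 < δ)
    {f : EuclideanSpace ℝ (Fin n) → ℝ} (hf : Continuous f) (hfc : HasCompactSupport f) :
    Tendsto (fun x => ∫ y in (Metric.closedBall x₀ δ)ᶜ, Γ x y * f y) (𝓝 x₀)
      (𝓝 (∫ y in (Metric.closedBall x₀ δ)ᶜ, Γ x₀ y * f y)) := by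
  have hK : IsCompact (Metric.closedBall x₀ (δ / 2) ×ˢ (tsupport f \ Metric.ball x₀ δ)) :=
    (isCompact_closedBall _ _).prod (IsCompact.diff hfc Metric.isOpen_ball)
  obtain ⟨C, hC⟩ := hK.exists_bound_of_continuousOn (f := Function.uncurry Γ)
    (hΓ.smooth.continuousOn.mono fun p hp h => by
      have h1 : dist p.1 x₀ ≤ δ / 2 := hp.1
      have h2 : ¬ dist p.2 x₀ < δ := hp.2.2
      rw [h] at h1
      exact h2 (by linarith))
  refine tendsto_integral_filter_of_dominated_convergence (fun y => C * ‖f y‖)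
    (Eventually.of_forall fun x => (hΓ.integrable_mul x hf hfc).integrableOn.aestronglyMeasurable)
    ?_ ((hf.integrable_of_hasCompactSupport hfc).norm.const_mul C).integrableOn ?_
  · filter_upwards [Metric.closedBall_mem_nhds x₀ (half_pos hδ)] with x hx
    refine (ae_restrict_iff' measurableSet_closedBall.compl).2 (Eventually.of_forall fun y hy => ?_)
    rw [norm_mul]
    by_cases hyf : y ∈ tsupport f
    · exact mul_le_mul_of_nonneg_right
        (hC (x, y) ⟨hx, hyf, fun h => hy (Metric.ball_subset_closedBall h)⟩) (norm_nonneg _)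
    · simp [image_eq_zero_of_notMem_tsupport hyf]
  · refine (ae_restrict_iff' measurableSet_closedBall.compl).2 (Eventually.of_forall fun y hy => ?_)
    have hne : x₀ ≠ y := by
      rintro rfl
      exact hy (Metric.mem_closedBall_self hδ.le)
    exact ((hΓ.continuousAt hne).tendsto.comp
      ((continuous_id.prodMk continuous_const).tendsto x₀)).mul_const _

/-- The potential of a continuous compactly supported function is continuous. Near `x₀` pick a test
function `φ` with `L φ > 0` on a ball: the integral of `Γ x · L φ` over the ball is `-φ x` minus
the contribution of the complement, hence continuous at `x₀`, and Scheffé's lemma upgrades this to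
convergence of `Γ x` to `Γ x₀` in `L¹` of the ball. -/
theorem continuous_potential (hΓ : L.IsFundamentalSolution Γ)
    {f : EuclideanSpace ℝ (Fin n) → ℝ} (hf : Continuous f) (hfc : HasCompactSupport f) :
    Continuous (potential Γ f) := by
  rw [continuous_iff_continuousAt]
  intro x₀
  obtain ⟨φ, hφ, hφc, hpos⟩ := L.exists_op_pos x₀
  have hq : Continuous (L.op φ) := (L.contDiff_op hφ).continuous
  have hqc : HasCompactSupport (L.op φ) :=
    hφc.of_isClosed_subset (isClosed_tsupport _) (L.tsupport_op_subset φ)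
  obtain ⟨δ, hδ, hball⟩ : ∃ δ > 0, ∀ y ∈ Metric.closedBall x₀ δ, L.op φ x₀ / 2 < L.op φ y := by
    have h := hq.continuousAt.eventually (lt_mem_nhds (half_lt_self hpos))
    obtain ⟨δ, hδ, h⟩ := Metric.nhds_basis_closedBall.mem_iff.1 h
    exact ⟨δ, hδ, h⟩
  obtain ⟨C, hC⟩ := hfc.exists_bound_of_continuous hf
  set B := Metric.closedBall x₀ δ
  have hBm : MeasurableSet B := measurableSet_closedBall
  have hsplit : ∀ {g : EuclideanSpace ℝ (Fin n) → ℝ}, Continuous g → HasCompactSupport g → ∀ x,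
      ∫ y in B, Γ x y * g y = (∫ y, Γ x y * g y) - ∫ y in Bᶜ, Γ x y * g y := fun hg hgc x => by
    rw [← integral_add_compl hBm (hΓ.integrable_mul x hg hgc), add_sub_cancel_right]
  have hlimB : Tendsto (fun x => ∫ y in B, Γ x y * L.op φ y) (𝓝 x₀)
      (𝓝 (∫ y in B, Γ x₀ y * L.op φ y)) := by
    simp only [hsplit hq hqc, hΓ.fundamental φ hφ hφc]
    exact hφ.continuous.neg.continuousAt.tendsto.sub
      (hΓ.tendsto_setIntegral_compl_closedBall x₀ hδ hq hqc)
  have hsch := tendsto_integral_abs_sub_of_tendsto_integral (μ := volume.restrict B) (l := 𝓝 x₀)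
    (F := fun x y => Γ x y * L.op φ y) (fun x => (hΓ.integrable_mul x hq hqc).integrableOn)
    (hΓ.integrable_mul x₀ hq hqc).integrableOn
    (fun x => by
      refine (ae_restrict_iff' hBm).2 ?_
      filter_upwards [L.ae_ne x] with y hy hyB
      exact mul_nonneg (hΓ.pos x y hy.symm).le ((half_pos hpos).trans (hball y hyB)).le)
    (by
      filter_upwards [ae_restrict_of_ae (L.ae_ne x₀)] with y hy
      exact ((hΓ.continuousAt hy.symm).tendsto.comp
        ((continuous_id.prodMk continuous_const).tendsto x₀)).mul_const _)
    hlimB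
  have hnear : Tendsto (fun x => ∫ y in B, Γ x y * f y) (𝓝 x₀) (𝓝 (∫ y in B, Γ x₀ y * f y)) := by
    rw [tendsto_iff_norm_sub_tendsto_zero]
    refine squeeze_zero (fun _ => norm_nonneg _) (fun x => ?_)
      (by simpa using hsch.const_mul (C / (L.op φ x₀ / 2)))
    rw [← integral_sub (hΓ.integrable_mul x hf hfc).integrableOn
      (hΓ.integrable_mul x₀ hf hfc).integrableOn, ← integral_const_mul]
    refine (norm_integral_le_integral_norm _).trans (integral_mono_ae ?_ ?_ ?_)
    · exact ((hΓ.integrable_mul x hf hfc).sub (hΓ.integrable_mul x₀ hf hfc)).norm.integrableOn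
    · exact (((hΓ.integrable_mul x hq hqc).sub
        (hΓ.integrable_mul x₀ hq hqc)).abs.const_mul _).integrableOn
    · refine (ae_restrict_iff' hBm).2 (Eventually.of_forall fun y hy => ?_)
      have hm := half_pos hpos
      have hb := hball y hy
      simp only [← sub_mul, norm_mul, abs_mul, Real.norm_eq_abs]
      rw [abs_of_pos (hm.trans hb)]
      have h1 : |f y| ≤ C / (L.op φ x₀ / 2) * L.op φ y := by
        rw [div_mul_eq_mul_div, le_div_iff₀ hm]
        exact mul_le_mul (hC y) hb.le hm.le ((norm_nonneg _).trans (hC y))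
      calc |Γ x y - Γ x₀ y| * |f y| ≤ |Γ x y - Γ x₀ y| * (C / (L.op φ x₀ / 2) * L.op φ y) :=
            mul_le_mul_of_nonneg_left h1 (abs_nonneg _)
        _ = _ := by ring
  have h := hnear.add (hΓ.tendsto_setIntegral_compl_closedBall x₀ hδ hf hfc)
  have hadd : ∀ x, (∫ y in B, Γ x y * f y) + ∫ y in Bᶜ, Γ x y * f y = potential Γ f x := fun x =>
    integral_add_compl hBm (hΓ.integrable_mul x hf hfc)
  simp only [B, hadd] at h
  exact h

end IsFundamentalSolution

end DivFormOperator

/-! ### Smooth profiles and their double primitives -/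

/-- A smooth function on the line that vanishes on `(-∞, a]` and on `[b, ∞)`, where `0 < a`. -/
structure IsProfile (θ : ℝ → ℝ) (a b : ℝ) : Prop where
  contDiff : ContDiff ℝ ∞ θ
  pos : 0 < a
  zero_of_le : ∀ s ≤ a, θ s = 0
  zero_of_ge : ∀ s, b ≤ s → θ s = 0

/-- The second primitive `t ↦ ∫₀ᵗ (t - s) θ(s) ds` of `θ`. -/
noncomputable def secondPrimitive (θ : ℝ → ℝ) (t : ℝ) : ℝ :=
  t * (∫ s in (0 : ℝ)..t, θ s) - ∫ s in (0 : ℝ)..t, s * θ s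

namespace IsProfile

variable {θ η : ℝ → ℝ} {a b c d : ℝ}

theorem sub_const_mul (h : IsProfile θ a b) (h' : IsProfile η c d) (k : ℝ) :
    IsProfile (fun s => θ s - k * η s) (min a c) (max b d) where
  contDiff := h.contDiff.sub (contDiff_const.mul h'.contDiff)
  pos := lt_min h.pos h'.pos
  zero_of_le s hs := by
    rw [h.zero_of_le s (hs.trans (min_le_left _ _)), h'.zero_of_le s (hs.trans (min_le_right _ _))]
    simp
  zero_of_ge s hs := by
    rw [h.zero_of_ge s ((le_max_left _ _).trans hs), h'.zero_of_ge s ((le_max_right _ _).trans hs)]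
    simp

theorem id_mul (h : IsProfile θ a b) : IsProfile (fun s => s * θ s) a b :=
  ⟨contDiff_id.mul h.contDiff, h.pos, fun s hs => by simp [h.zero_of_le s hs],
    fun s hs => by simp [h.zero_of_ge s hs]⟩

theorem translate (h : IsProfile θ a b) {k : ℝ} (hk : 0 ≤ k) :
    IsProfile (fun s => θ (s - k)) (a + k) (b + k) :=
  ⟨h.contDiff.comp (contDiff_id.sub contDiff_const), by linarith [h.pos],
    fun s hs => h.zero_of_le _ (by linarith), fun s hs => h.zero_of_ge _ (by linarith)⟩

theorem support_subset (h : IsProfile θ a b) : Function.support θ ⊆ Ioo a b := fun s hs =>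
  ⟨not_le.1 fun h' => hs (h.zero_of_le s h'), not_le.1 fun h' => hs (h.zero_of_ge s h')⟩

theorem integrable (h : IsProfile θ a b) : Integrable θ := by
  refine h.contDiff.continuous.integrable_of_hasCompactSupport
    (HasCompactSupport.of_support_subset_isCompact (isCompact_Icc (a := a) (b := b)) ?_)
  exact h.support_subset.trans Ioo_subset_Icc_self

theorem intervalIntegral_eq (h : IsProfile θ a b) {t : ℝ} (ht : b ≤ t) :
    ∫ s in (0 : ℝ)..t, θ s = ∫ s, θ s :=
  intervalIntegral.integral_eq_integral_of_support_subset fun _ hs =>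
    ⟨h.pos.trans (h.support_subset hs).1, (h.support_subset hs).2.le.trans ht⟩

theorem intervalIntegral_eq_zero (h : IsProfile θ a b) {t : ℝ} (ht : t ≤ a) :
    ∫ s in (0 : ℝ)..t, θ s = 0 := by
  have : ∫ s in (0 : ℝ)..t, θ s = ∫ s in (0 : ℝ)..t, (0 : ℝ) :=
    intervalIntegral.integral_congr fun s hs =>
      h.zero_of_le s ((hs.2).trans (max_le h.pos.le ht))
  simpa using this

theorem hasDerivAt_secondPrimitive (h : IsProfile θ a b) (t : ℝ) :
    HasDerivAt (secondPrimitive θ) (∫ s in (0 : ℝ)..t, θ s) t := by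
  have h1 := (hasDerivAt_id t).mul (h.contDiff.continuous.integral_hasStrictDerivAt 0 t).hasDerivAt
  have h2 := (h.id_mul.contDiff.continuous.integral_hasStrictDerivAt 0 t).hasDerivAt
  refine (h1.sub h2).congr_deriv ?_
  simp

theorem deriv_secondPrimitive (h : IsProfile θ a b) :
    deriv (secondPrimitive θ) = fun t => ∫ s in (0 : ℝ)..t, θ s :=
  funext fun t => (h.hasDerivAt_secondPrimitive t).deriv

theorem deriv_deriv_secondPrimitive (h : IsProfile θ a b) :
    deriv (deriv (secondPrimitive θ)) = θ := by
  rw [h.deriv_secondPrimitive]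
  exact funext fun t => (h.contDiff.continuous.integral_hasStrictDerivAt 0 t).hasDerivAt.deriv

theorem contDiff_secondPrimitive (h : IsProfile θ a b) : ContDiff ℝ ∞ (secondPrimitive θ) := by
  refine contDiff_infty_iff_deriv.2
    ⟨fun t => (h.hasDerivAt_secondPrimitive t).differentiableAt, contDiff_infty_iff_deriv.2 ⟨?_, ?_⟩⟩
  · rw [h.deriv_secondPrimitive]
    exact fun t => (h.contDiff.continuous.integral_hasStrictDerivAt 0 t).hasDerivAt.differentiableAt
  · rw [h.deriv_deriv_secondPrimitive]
    exact h.contDiff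

theorem secondPrimitive_of_le (h : IsProfile θ a b) {t : ℝ} (ht : t ≤ a) :
    secondPrimitive θ t = 0 := by
  simp [secondPrimitive, h.intervalIntegral_eq_zero ht, h.id_mul.intervalIntegral_eq_zero ht]

theorem secondPrimitive_of_ge (h : IsProfile θ a b) (hm : ∫ s, θ s = 0) {t : ℝ} (ht : b ≤ t) :
    secondPrimitive θ t = -∫ s, s * θ s := by
  simp [secondPrimitive, h.intervalIntegral_eq ht, h.id_mul.intervalIntegral_eq ht, hm]

theorem secondPrimitive_sub_const_mul (h : IsProfile θ a b) (h' : IsProfile η c d) (k t : ℝ) :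
    secondPrimitive (fun s => θ s - k * η s) t =
      secondPrimitive θ t - k * secondPrimitive η t := by
  have e : (fun s => s * (θ s - k * η s)) = fun s => s * θ s - k * (s * η s) := by
    ext s
    ring
  unfold secondPrimitive
  rw [e, intervalIntegral.integral_sub, intervalIntegral.integral_sub,
    intervalIntegral.integral_const_mul, intervalIntegral.integral_const_mul]
  · ring
  · exact h.id_mul.contDiff.continuous.intervalIntegrable _ _
  · exact (h'.id_mul.contDiff.continuous.intervalIntegrable _ _).const_mul _
  · exact h.contDiff.continuous.intervalIntegrable _ _
  · exact (h'.contDiff.continuous.intervalIntegrable _ _).const_mul _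

/-- `∫ θ(s) min(g, s) ds = g ∫ θ - ∫ θ(s) (g - s)⁺ ds`. -/
theorem integral_mul_min (h : IsProfile θ a b) {g : ℝ} (hg : 0 ≤ g) :
    ∫ s, θ s * min g s = g * (∫ s, θ s) - secondPrimitive θ g := by
  have hθ := h.contDiff.continuous
  set t := max b g
  have hgt : g ≤ t := le_max_right _ _
  have h1 : ∫ s, θ s * min g s = ∫ s in (0 : ℝ)..t, θ s * min g s := by
    refine (intervalIntegral.integral_eq_integral_of_support_subset fun s hs => ?_).symm
    have := h.support_subset (left_ne_zero_of_mul hs)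
    exact ⟨h.pos.trans this.1, this.2.le.trans (le_max_left _ _)⟩
  have hc : Continuous fun s => θ s * min g s := hθ.mul (continuous_const.min continuous_id)
  have h2 : ∫ s in (0 : ℝ)..g, θ s * min g s = ∫ s in (0 : ℝ)..g, s * θ s := by
    refine intervalIntegral.integral_congr fun s hs => ?_
    rw [uIcc_of_le hg] at hs
    simp only [min_eq_right hs.2, mul_comm]
  have h3 : ∫ s in g..t, θ s * min g s = g * ∫ s in g..t, θ s := by
    rw [← intervalIntegral.integral_const_mul]
    refine intervalIntegral.integral_congr fun s hs => ?_
    rw [uIcc_of_le hgt] at hs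
    simp only [min_eq_left hs.1, mul_comm]
  have h4 := intervalIntegral.integral_add_adjacent_intervals
    (hc.intervalIntegrable (μ := volume) 0 g) (hc.intervalIntegrable (μ := volume) g t)
  have h5 := intervalIntegral.integral_add_adjacent_intervals
    (hθ.intervalIntegrable (μ := volume) 0 g) (hθ.intervalIntegrable (μ := volume) g t)
  rw [h1, ← h4, h2, h3, ← h.intervalIntegral_eq (le_max_left b g), ← h5, secondPrimitive]
  ring

end IsProfile

/-- A nonnegative profile of total mass one. -/
theorem exists_isProfile_integral_eq_one :
    ∃ θ : ℝ → ℝ, IsProfile θ 1 3 ∧ (∀ s, 0 ≤ θ s) ∧ ∫ s, θ s = 1 := by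
  let β : ContDiffBump (2 : ℝ) := ⟨1 / 2, 1, by norm_num, by norm_num⟩
  have hz : ∀ s : ℝ, 1 ≤ dist s 2 → β.normed volume s = 0 := fun s hs => by
    have h : s ∉ Function.support (β.normed volume) := by
      rw [β.support_normed_eq, Metric.mem_ball]
      exact not_lt.2 hs
    simpa using h
  refine ⟨β.normed volume, ⟨β.contDiff_normed, one_pos, fun s hs => hz s ?_, fun s hs => hz s ?_⟩,
    fun s => β.nonneg_normed s, β.integral_normed⟩
  · rw [Real.dist_eq, abs_of_nonpos (by linarith)]
    linarith
  · rw [Real.dist_eq, abs_of_nonneg (by linarith)]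
    linarith

/-! ### The distribution of the energy over the level sets -/

namespace DivFormOperator

variable {n : ℕ} {L : DivFormOperator n}
  {Γ : EuclideanSpace ℝ (Fin n) → EuclideanSpace ℝ (Fin n) → ℝ}

variable (L Γ) in
/-- The function `y ↦ θ(Γ(x,y)) ⟨A(y) ∇_y Γ(x,y), ∇_y Γ(x,y)⟩`, with the value `0` at `y = x`. -/
noncomputable def levelDensity (x : EuclideanSpace ℝ (Fin n)) (θ : ℝ → ℝ) :
    EuclideanSpace ℝ (Fin n) → ℝ :=
  Function.update (fun y => θ (Γ x y) * L.energy (Γ x) y) x 0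

theorem levelDensity_self (x : EuclideanSpace ℝ (Fin n)) (θ : ℝ → ℝ) :
    L.levelDensity Γ x θ x = 0 := Function.update_self ..

theorem levelDensity_of_ne {x y : EuclideanSpace ℝ (Fin n)} (h : y ≠ x) (θ : ℝ → ℝ) :
    L.levelDensity Γ x θ y = θ (Γ x y) * L.energy (Γ x) y := Function.update_of_ne h ..

theorem levelDensity_nonneg (x y : EuclideanSpace ℝ (Fin n)) {θ : ℝ → ℝ} (hθ : ∀ s, 0 ≤ θ s) :
    0 ≤ L.levelDensity Γ x θ y := by
  rcases eq_or_ne y x with rfl | h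
  · rw [levelDensity_self]
  · rw [levelDensity_of_ne h]
    exact mul_nonneg (hθ _) (L.energy_nonneg _ _)

theorem levelDensity_sub_const_mul (x y : EuclideanSpace ℝ (Fin n)) (θ η : ℝ → ℝ) (k : ℝ) :
    L.levelDensity Γ x (fun s => θ s - k * η s) y =
      L.levelDensity Γ x θ y - k * L.levelDensity Γ x η y := by
  rcases eq_or_ne y x with rfl | h
  · simp [levelDensity_self]
  · simp only [levelDensity_of_ne h]
    ring

namespace IsFundamentalSolution

/-- Quantitatively, `Ω_r(x)` shrinks to `x`: off every ball about `x` the function `Γ x` is bounded above. -/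
theorem exists_le_of_notMem_ball (hΓ : L.IsFundamentalSolution Γ)
    (x : EuclideanSpace ℝ (Fin n)) {δ : ℝ} (hδ : 0 < δ) :
    ∃ T > 0, ∀ y ∉ Metric.ball x δ, Γ x y ≤ T := by
  obtain ⟨K, hK, hsub⟩ := mem_cocompact.1
    ((hΓ.tendsto_cocompact x).eventually (gt_mem_nhds one_pos))
  obtain ⟨C, hC⟩ := (hK.diff (Metric.isOpen_ball (x := x) (ε := δ))).exists_bound_of_continuousOn
    (f := Γ x) ((hΓ.contDiffOn x).continuousOn.mono fun y hy h => hy.2 (by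
      rw [mem_singleton_iff.1 h]
      exact Metric.mem_ball_self hδ))
  refine ⟨max 1 C, lt_max_of_lt_left one_pos, fun y hy => ?_⟩
  by_cases hyK : y ∈ K
  · exact (le_abs_self _).trans ((hC y ⟨hyK, hy⟩).trans (le_max_right _ _))
  · have h1 : Γ x y < 1 := hsub hyK
    exact h1.le.trans (le_max_left _ _)

theorem hasCompactSupport_update (hΓ : L.IsFundamentalSolution Γ)
    (x : EuclideanSpace ℝ (Fin n)) {w : EuclideanSpace ℝ (Fin n) → ℝ} {a : ℝ} (ha : 0 < a)
    (hw : ∀ y, Γ x y ≤ a → w y = 0) (c : ℝ) :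
    HasCompactSupport (Function.update w x c) := by
  obtain ⟨K, hK, hsub⟩ := mem_cocompact.1
    ((hΓ.tendsto_cocompact x).eventually (gt_mem_nhds ha))
  refine HasCompactSupport.intro (hK.union (isCompact_singleton (x := x))) fun y hy => ?_
  rw [mem_union, not_or] at hy
  rw [Function.update_of_ne hy.2]
  have h1 : Γ x y < a := hsub hy.1
  exact hw y h1.le

/-- If `w` is constant on a superlevel set of `Γ x`, then filling in this constant at `x` makes `w`
locally constant at `x`. -/
theorem update_eventuallyEq (hΓ : L.IsFundamentalSolution Γ)
    (x : EuclideanSpace ℝ (Fin n)) {w : EuclideanSpace ℝ (Fin n) → ℝ} {b c : ℝ}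
    (hw : ∀ y, b ≤ Γ x y → w y = c) :
    Function.update w x c =ᶠ[𝓝 x] fun _ => c := by
  have h := eventually_nhdsWithin_iff.1 ((hΓ.tendsto_atTop x).eventually_ge_atTop b)
  filter_upwards [h] with y hy
  rcases eq_or_ne y x with rfl | hne
  · exact Function.update_self ..
  · rw [Function.update_of_ne hne]
    exact hw y (hy hne)

theorem update_eventuallyEq_of_ne {x y : EuclideanSpace ℝ (Fin n)} (h : y ≠ x)
    (w : EuclideanSpace ℝ (Fin n) → ℝ) (c : ℝ) : Function.update w x c =ᶠ[𝓝 y] w := by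
  filter_upwards [isOpen_compl_singleton.mem_nhds h] with z hz
  exact Function.update_of_ne hz ..

theorem continuous_levelDensity (hΓ : L.IsFundamentalSolution Γ)
    (x : EuclideanSpace ℝ (Fin n)) {θ : ℝ → ℝ} {a b : ℝ} (h : IsProfile θ a b) :
    Continuous (L.levelDensity Γ x θ) := by
  rw [continuous_iff_continuousAt]
  intro y
  rcases eq_or_ne y x with rfl | hne
  · have h1 := hΓ.update_eventuallyEq y (w := fun z => θ (Γ y z) * L.energy (Γ y) z) (b := b)
      (c := 0) fun z hz => by simp [h.zero_of_ge _ hz]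
    exact continuousAt_const.congr h1.symm
  · refine ContinuousAt.congr ?_ (update_eventuallyEq_of_ne hne _ 0).symm
    exact (h.contDiff.continuous.continuousAt.comp (hΓ.contDiffAt hne).continuousAt).mul
      ((L.continuousOn_energy isOpen_compl_singleton (hΓ.contDiffOn x)).continuousAt
        (isOpen_compl_singleton.mem_nhds hne))

theorem hasCompactSupport_levelDensity (hΓ : L.IsFundamentalSolution Γ)
    (x : EuclideanSpace ℝ (Fin n)) {θ : ℝ → ℝ} {a b : ℝ} (h : IsProfile θ a b) :
    HasCompactSupport (L.levelDensity Γ x θ) :=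
  hΓ.hasCompactSupport_update x h.pos (fun y hy => by simp [h.zero_of_le _ hy]) 0

theorem integrable_levelDensity (hΓ : L.IsFundamentalSolution Γ)
    (x : EuclideanSpace ℝ (Fin n)) {θ : ℝ → ℝ} {a b : ℝ} (h : IsProfile θ a b) :
    Integrable (L.levelDensity Γ x θ) :=
  (hΓ.continuous_levelDensity x h).integrable_of_hasCompactSupport
    (hΓ.hasCompactSupport_levelDensity x h)

theorem integrable_mul_levelDensity (hΓ : L.IsFundamentalSolution Γ)
    (z x : EuclideanSpace ℝ (Fin n)) {θ : ℝ → ℝ} {a b : ℝ} (h : IsProfile θ a b) :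
    Integrable (fun y => Γ z y * L.levelDensity Γ x θ y) :=
  hΓ.integrable_mul z (hΓ.continuous_levelDensity x h) (hΓ.hasCompactSupport_levelDensity x h)

/-- For a profile `θ` of mean zero with second primitive `h`, the function `h ∘ Γ x`, extended to
`x` by the value of `h` near `∞`, is a test function, and `L` maps it to the level density. -/
theorem exists_op_eq_levelDensity (hΓ : L.IsFundamentalSolution Γ)
    (x : EuclideanSpace ℝ (Fin n)) {θ : ℝ → ℝ} {a b : ℝ} (h : IsProfile θ a b)
    (hm : ∫ s, θ s = 0) :
    ∃ φ : EuclideanSpace ℝ (Fin n) → ℝ, ContDiff ℝ ∞ φ ∧ HasCompactSupport φ ∧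
      L.op φ = L.levelDensity Γ x θ ∧ φ x = -(∫ s, s * θ s) ∧
      ∀ z ≠ x, φ z = secondPrimitive θ (Γ x z) := by
  set C := -∫ s, s * θ s
  have hx := hΓ.update_eventuallyEq x (w := fun y => secondPrimitive θ (Γ x y)) (b := b) (c := C)
    fun y hy => h.secondPrimitive_of_ge hm hy
  refine ⟨Function.update (fun y => secondPrimitive θ (Γ x y)) x C, ?_, ?_, ?_,
    Function.update_self .., fun z hz => Function.update_of_ne hz ..⟩
  · rw [contDiff_iff_contDiffAt]
    intro y
    rcases eq_or_ne y x with rfl | hne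
    · exact contDiffAt_const.congr_of_eventuallyEq hx
    · exact (h.contDiff_secondPrimitive.contDiffAt.comp y
        (hΓ.contDiffAt hne)).congr_of_eventuallyEq (update_eventuallyEq_of_ne hne _ _)
  · exact hΓ.hasCompactSupport_update x h.pos (fun y hy => h.secondPrimitive_of_le hy) C
  · ext y
    rcases eq_or_ne y x with rfl | hne
    · rw [L.op_congr hx, op_const, levelDensity_self]
    · rw [L.op_congr (update_eventuallyEq_of_ne hne _ _),
        L.op_comp isOpen_compl_singleton (hΓ.contDiffOn x) h.contDiff_secondPrimitive
          (mem_compl_singleton_iff.2 hne),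
        hΓ.op_eq_zero hne, mul_zero, add_zero, h.deriv_deriv_secondPrimitive,
        levelDensity_of_ne hne]

/-- The image of the measure `⟨A ∇Γ(x,·), ∇Γ(x,·)⟩ dy` under `Γ x` is the Lebesgue measure of the
half line. Mean zero profiles give this up to a constant factor, and testing the fundamental
solution property at `x` itself determines the factor. -/
theorem integral_levelDensity (hΓ : L.IsFundamentalSolution Γ)
    (x : EuclideanSpace ℝ (Fin n)) {θ : ℝ → ℝ} {a b : ℝ} (h : IsProfile θ a b) :
    ∫ y, L.levelDensity Γ x θ y = ∫ s, θ s := by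
  obtain ⟨η, hη, -, hη1⟩ := exists_isProfile_integral_eq_one
  set c := ∫ y, L.levelDensity Γ x η y
  have hc : ∀ {ψ : ℝ → ℝ} {a' b' : ℝ}, IsProfile ψ a' b' →
      ∫ y, L.levelDensity Γ x ψ y = (∫ s, ψ s) * c := by
    intro ψ a' b' hψ
    have hp := hψ.sub_const_mul hη (∫ s, ψ s)
    have hm : ∫ s, (ψ s - (∫ s, ψ s) * η s) = 0 := by
      rw [integral_sub hψ.integrable (hη.integrable.const_mul _), integral_const_mul, hη1]
      ring
    obtain ⟨φ, hφ, hφc, hop, -, -⟩ := hΓ.exists_op_eq_levelDensity x hp hm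
    have h0 := L.integral_op_eq_zero hφ hφc
    simp only [hop, levelDensity_sub_const_mul] at h0
    rw [integral_sub (hΓ.integrable_levelDensity x hψ)
      ((hΓ.integrable_levelDensity x hη).const_mul _), integral_const_mul] at h0
    linarith
  suffices hc1 : c = 1 by rw [hc h, hc1, mul_one]
  -- a profile of mean zero and first moment one
  have ht := hη.translate zero_le_one
  have hp := ht.sub_const_mul hη 1
  have htm : ∫ s, η (s - 1) = 1 := by rw [integral_sub_right_eq_self η (1 : ℝ), hη1]
  have hm : ∫ s, (η (s - 1) - 1 * η s) = 0 := by
    rw [integral_sub ht.integrable (hη.integrable.const_mul _), integral_const_mul, htm, hη1]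
    ring
  have hm1 : ∫ s, s * (η (s - 1) - 1 * η s) = 1 := by
    have e1 : ∫ s, s * η (s - 1) = (∫ s, s * η s) + 1 := by
      have := integral_sub_right_eq_self (μ := volume) (fun s => (s + 1) * η s) (1 : ℝ)
      simp only [sub_add_cancel] at this
      rw [this]
      simp only [add_mul, one_mul]
      rw [integral_add hη.id_mul.integrable hη.integrable, hη1]
    have e2 : (fun s => s * (η (s - 1) - 1 * η s)) = fun s => s * η (s - 1) - s * η s := by
      ext s
      ring
    rw [e2, integral_sub ht.id_mul.integrable hη.id_mul.integrable, e1]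
    ring
  obtain ⟨φ, hφ, hφc, hop, hφx, -⟩ := hΓ.exists_op_eq_levelDensity x hp hm
  have hfund := hΓ.fundamental φ hφ hφc x
  rw [hop, hφx, neg_neg, hm1] at hfund
  have hmul : ∫ y, L.levelDensity Γ x (fun s => s * (η (s - 1) - 1 * η s)) y = 1 := by
    refine Eq.trans (integral_congr_ae (Eventually.of_forall fun y => ?_)) hfund
    rcases eq_or_ne y x with rfl | hne
    · simp [levelDensity_self]
    · simp only [levelDensity_of_ne hne]
      ring
  rw [hc hp.id_mul, hm1, one_mul] at hmul
  exact hmul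

/-- The image of the measure `Γ(z,·) ⟨A ∇Γ(x,·), ∇Γ(x,·)⟩ dy` under `Γ x` has density
`s ↦ min (Γ(x,z)) s`. Mean zero profiles give this up to an additive constant; profiles supported
near `∞` only see the level sets close to `x`, where `Γ z` is close to `Γ(x,z)`, and so show that
the constant vanishes. -/
theorem integral_mul_levelDensity (hΓ : L.IsFundamentalSolution Γ)
    {x z : EuclideanSpace ℝ (Fin n)} (hz : z ≠ x) {θ : ℝ → ℝ} {a b : ℝ} (h : IsProfile θ a b) :
    ∫ y, Γ z y * L.levelDensity Γ x θ y = ∫ s, θ s * min (Γ x z) s := by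
  rw [h.integral_mul_min (hΓ.pos x z hz.symm).le]
  set g := Γ x z with hg
  obtain ⟨η, hη, hη0, hη1⟩ := exists_isProfile_integral_eq_one
  -- the additive constant left undetermined by profiles of mean zero
  set c := (∫ y, Γ z y * L.levelDensity Γ x η y) + secondPrimitive η g with hcdef
  have hc : ∀ {ψ : ℝ → ℝ} {a' b' : ℝ}, IsProfile ψ a' b' →
      ∫ y, Γ z y * L.levelDensity Γ x ψ y = c * (∫ s, ψ s) - secondPrimitive ψ g := by
    intro ψ a' b' hψ
    have hp := hψ.sub_const_mul hη (∫ s, ψ s)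
    have hm : ∫ s, (ψ s - (∫ s, ψ s) * η s) = 0 := by
      rw [integral_sub hψ.integrable (hη.integrable.const_mul _), integral_const_mul, hη1]
      ring
    obtain ⟨φ, hφ, hφc, hop, -, hφz⟩ := hΓ.exists_op_eq_levelDensity x hp hm
    have h0 := hΓ.fundamental φ hφ hφc z
    rw [hop, hφz z hz, hψ.secondPrimitive_sub_const_mul hη] at h0
    simp only [levelDensity_sub_const_mul, mul_sub, mul_left_comm _ (∫ s, ψ s)] at h0
    rw [integral_sub (hΓ.integrable_mul_levelDensity z x hψ)
      ((hΓ.integrable_mul_levelDensity z x hη).const_mul _), integral_const_mul] at h0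
    rw [hcdef]
    linarith
  suffices hcg : c = g by rw [hc h, hcg]
  refine eq_of_forall_dist_le fun ε hε => ?_
  have hcont : ContinuousAt (Γ z) x := (hΓ.contDiffAt hz.symm).continuousAt
  obtain ⟨δ, hδ, hball⟩ := Metric.continuousAt_iff.1 hcont ε hε
  obtain ⟨T, hT, hTle⟩ := hΓ.exists_le_of_notMem_ball x hδ
  -- translated by `T + g`, the profile only sees the ball, and its second primitive vanishes at `g`
  have hk : 0 ≤ T + g := by linarith [hΓ.pos x z hz.symm]
  have hp := hη.translate hk
  have hpm : ∫ s, η (s - (T + g)) = 1 := by rw [integral_sub_right_eq_self η, hη1]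
  have h1 := hc hp
  rw [hp.secondPrimitive_of_le (by linarith), hpm, sub_zero, mul_one] at h1
  have h2 := hΓ.integral_levelDensity x hp
  rw [hpm] at h2
  rw [Real.dist_eq, ← h1]
  calc |(∫ y, Γ z y * L.levelDensity Γ x (fun s => η (s - (T + g))) y) - g|
      = ‖∫ y, (Γ z y - g) * L.levelDensity Γ x (fun s => η (s - (T + g))) y‖ := by
        simp only [sub_mul]
        rw [integral_sub (hΓ.integrable_mul_levelDensity z x hp)
          ((hΓ.integrable_levelDensity x hp).const_mul _), integral_const_mul, h2, mul_one,
          Real.norm_eq_abs]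
    _ ≤ ∫ y, ε * L.levelDensity Γ x (fun s => η (s - (T + g))) y := by
        refine norm_integral_le_of_norm_le ((hΓ.integrable_levelDensity x hp).const_mul ε)
          (Eventually.of_forall fun y => ?_)
        have h0 := levelDensity_nonneg (L := L) (Γ := Γ) x y (θ := fun s => η (s - (T + g)))
          fun s => hη0 _
        rw [norm_mul, Real.norm_of_nonneg h0]
        by_cases hy : y ∈ Metric.ball x δ
        · refine mul_le_mul_of_nonneg_right ?_ h0
          have := hball hy
          rw [Real.dist_eq, ← hΓ.symm x z hz.symm] at this
          exact this.le
        · have hyx : y ≠ x := by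
            rintro rfl
            exact hy (Metric.mem_ball_self hδ)
          rw [levelDensity_of_ne hyx,
            hp.zero_of_le _ (by linarith [hTle y hy, hΓ.pos x z hz.symm])]
          simp
    _ = ε := by rw [integral_const_mul, h2, mul_one]

end IsFundamentalSolution

end DivFormOperator

/-! ### Average of the fundamental solution over an `L`-ball -/

/-- A smooth compactly supported approximation from below of `s ↦ s ^ (-(α + 2))` on `(a, ∞)`. -/
noncomputable def powProfile (α a : ℝ) (k : ℕ) (s : ℝ) : ℝ :=
  s ^ (-(α + 2)) * (Real.smoothTransition (k * (s - a)) * Real.smoothTransition (k - s))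

theorem powProfile_of_le {α a : ℝ} (k : ℕ) {s : ℝ} (hs : s ≤ a) : powProfile α a k s = 0 := by
  have h : (k : ℝ) * (s - a) ≤ 0 := mul_nonpos_of_nonneg_of_nonpos k.cast_nonneg (by linarith)
  simp [powProfile, Real.smoothTransition.zero_of_nonpos h]

theorem isProfile_powProfile (α : ℝ) {a : ℝ} (ha : 0 < a) (k : ℕ) :
    IsProfile (powProfile α a k) a k where
  contDiff := by
    rw [contDiff_iff_contDiffAt]
    intro s
    rcases lt_or_ge s a with hs | hs
    · refine (contDiffAt_const (c := (0 : ℝ))).congr_of_eventuallyEq ?_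
      filter_upwards [Iio_mem_nhds hs] with t ht
      exact powProfile_of_le k (le_of_lt ht)
    · refine (Real.contDiffAt_rpow_const_of_ne (ha.trans_le hs).ne').mul (ContDiffAt.mul ?_ ?_)
      · exact Real.smoothTransition.contDiff.contDiffAt.comp s
          (contDiffAt_const.mul (contDiffAt_id.sub contDiffAt_const))
      · exact Real.smoothTransition.contDiff.contDiffAt.comp s (contDiffAt_const.sub contDiffAt_id)
  pos := ha
  zero_of_le s hs := powProfile_of_le k hs
  zero_of_ge s hs := by
    simp [powProfile, Real.smoothTransition.zero_of_nonpos (sub_nonpos.2 hs)]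

theorem powProfile_nonneg {α a : ℝ} (ha : 0 < a) (k : ℕ) (s : ℝ) : 0 ≤ powProfile α a k s := by
  rcases le_or_gt s a with hs | hs
  · rw [powProfile_of_le k hs]
  · exact mul_nonneg (Real.rpow_nonneg (ha.trans hs).le _)
      (mul_nonneg (Real.smoothTransition.nonneg _) (Real.smoothTransition.nonneg _))

theorem monotone_powProfile {α a : ℝ} (ha : 0 < a) (s : ℝ) :
    Monotone fun k => powProfile α a k s := by
  intro k l hkl
  have hkl' : (k : ℝ) ≤ l := Nat.cast_le.2 hkl
  rcases le_or_gt s a with hs | hs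
  · simp only [powProfile_of_le _ hs, le_refl]
  · refine mul_le_mul_of_nonneg_left ?_ (Real.rpow_nonneg (ha.trans hs).le _)
    exact mul_le_mul
      (Real.smoothTransition.monotone (mul_le_mul_of_nonneg_right hkl' (by linarith)))
      (Real.smoothTransition.monotone (by linarith))
      (Real.smoothTransition.nonneg _) (Real.smoothTransition.nonneg _)

theorem tendsto_powProfile (α a s : ℝ) :
    Tendsto (fun k => powProfile α a k s) atTop
      (𝓝 ((Ioi a).indicator (fun s => s ^ (-(α + 2))) s)) := by
  rcases le_or_gt s a with hs | hs
  · simp only [powProfile_of_le _ hs]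
    rw [indicator_of_notMem (show s ∉ Ioi a from not_lt.2 hs)]
    exact tendsto_const_nhds
  · rw [indicator_of_mem (show s ∈ Ioi a from hs)]
    refine tendsto_const_nhds.congr' ?_
    have h1 : Tendsto (fun k : ℕ => (k : ℝ) * (s - a)) atTop atTop :=
      tendsto_natCast_atTop_atTop.atTop_mul_const (sub_pos.2 hs)
    filter_upwards [h1.eventually_ge_atTop 1,
      tendsto_natCast_atTop_atTop.eventually_ge_atTop (1 + s)] with k hk hk'
    rw [powProfile, Real.smoothTransition.one_of_one_le hk,
      Real.smoothTransition.one_of_one_le (by linarith)]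
    simp

/-- The change of variables `s = 1 / ρ`. -/
theorem setLIntegral_Ioi_rpow_mul_min {α r : ℝ} (hr : 0 < r) (g : ℝ) :
    ∫⁻ s in Ioi (1 / r), ENNReal.ofReal (s ^ (-(α + 2)) * min g s) =
      ∫⁻ ρ in Ioc 0 r, ENNReal.ofReal (ρ ^ α * min g (1 / ρ)) := by
  have himg : (fun ρ : ℝ => ρ⁻¹) '' Ioo 0 r = Ioi (1 / r) := by
    rw [image_inv_eq_inv, inv_Ioo_0_left hr, one_div]
  rw [← himg, lintegral_image_eq_lintegral_abs_deriv_mul measurableSet_Ioo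
    (f' := fun ρ => -(ρ ^ 2)⁻¹)
    (fun ρ hρ => (hasDerivAt_inv hρ.1.ne').hasDerivWithinAt) inv_injective.injOn,
    ← setLIntegral_congr Ioo_ae_eq_Ioc]
  refine setLIntegral_congr_fun measurableSet_Ioo fun ρ hρ => ?_
  have hρ0 : 0 < ρ := hρ.1
  rw [← ENNReal.ofReal_mul (abs_nonneg _), abs_neg, abs_of_pos (by positivity),
    Real.inv_rpow hρ0.le, ← Real.rpow_neg hρ0.le, neg_neg, Real.rpow_add hρ0, Real.rpow_two,
    one_div]
  congr 1
  field_simp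

namespace DivFormOperator

variable {n : ℕ} {L : DivFormOperator n}
  {Γ : EuclideanSpace ℝ (Fin n) → EuclideanSpace ℝ (Fin n) → ℝ}

theorem kernel_eq (α : ℝ) (x y : EuclideanSpace ℝ (Fin n)) :
    L.kernel Γ α x y = L.energy (Γ x) y / Γ x y ^ (α + 2) := rfl

namespace IsFundamentalSolution

theorem kernel_nonneg (hΓ : L.IsFundamentalSolution Γ) (α : ℝ)
    {x y : EuclideanSpace ℝ (Fin n)} (h : y ≠ x) : 0 ≤ L.kernel Γ α x y :=
  div_nonneg (L.energy_nonneg _ _) (Real.rpow_nonneg (hΓ.pos x y h.symm).le _)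

theorem isOpen_lBall (hΓ : L.IsFundamentalSolution Γ) (r : ℝ) (x : EuclideanSpace ℝ (Fin n)) :
    IsOpen (lBall Γ r x) := by
  rw [isOpen_iff_mem_nhds]
  intro y hy
  rcases eq_or_ne y x with rfl | hne
  · have h := eventually_nhdsWithin_iff.1 ((hΓ.tendsto_atTop y).eventually_gt_atTop (1 / r))
    filter_upwards [h] with z hz
    exact or_iff_not_imp_left.2 hz
  · have h1 : 1 / r < Γ x y := hy.resolve_left hne
    filter_upwards [(hΓ.contDiffAt hne).continuousAt.eventually (lt_mem_nhds h1)] with z hz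
    exact Or.inr hz

theorem measurableSet_lBall (hΓ : L.IsFundamentalSolution Γ) (r : ℝ)
    (x : EuclideanSpace ℝ (Fin n)) : MeasurableSet (lBall Γ r x) :=
  (hΓ.isOpen_lBall r x).measurableSet

theorem aestronglyMeasurable (hΓ : L.IsFundamentalSolution Γ) (x : EuclideanSpace ℝ (Fin n)) :
    AEStronglyMeasurable (Γ x) volume :=
  (hΓ.locallyIntegrable x).aestronglyMeasurable

theorem aestronglyMeasurable_kernel (hΓ : L.IsFundamentalSolution Γ) (α : ℝ)
    (x : EuclideanSpace ℝ (Fin n)) : AEStronglyMeasurable (L.kernel Γ α x) volume := by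
  have hc : ContinuousOn (L.kernel Γ α x) {x}ᶜ :=
    (L.continuousOn_energy isOpen_compl_singleton (hΓ.contDiffOn x)).div
      ((hΓ.contDiffOn x).continuousOn.rpow_const fun y hy => Or.inl (hΓ.pos x y (Ne.symm hy)).ne')
      fun y hy => (Real.rpow_pos_of_pos (hΓ.pos x y (Ne.symm hy)) _).ne'
  have h := hc.aestronglyMeasurable (μ := volume) (measurableSet_singleton x).compl
  rwa [Measure.restrict_eq_self_of_ae_mem] at h
  exact L.ae_ne x

theorem aestronglyMeasurable_uncurry (hΓ : L.IsFundamentalSolution Γ) :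
    AEStronglyMeasurable (Function.uncurry Γ)
      ((volume : Measure (EuclideanSpace ℝ (Fin n))).prod volume) := by
  have h := hΓ.smooth.continuousOn.aestronglyMeasurable
    (μ := (volume : Measure (EuclideanSpace ℝ (Fin n))).prod volume) isOpen_offDiag.measurableSet
  rwa [Measure.restrict_eq_self_of_ae_mem] at h
  have hm : MeasurableSet {p : EuclideanSpace ℝ (Fin n) × EuclideanSpace ℝ (Fin n) |
      p.1 ≠ p.2} := isOpen_offDiag.measurableSet
  refine (Measure.measure_prod_null hm.compl).2 (Eventually.of_forall fun x => ?_)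
  have h0 := ae_iff.1 (L.ae_ne x)
  refine measure_mono_null (fun y hy => ?_) h0
  simp only [mem_preimage, mem_compl_iff, mem_ofPred_eq, not_not] at hy ⊢
  exact hy.symm

/-- The distribution of `Γ z` over the level sets of `Γ x`, tested on `s ^ (-(α + 2))` over
`(1/r, ∞)` by monotone approximation. The average is taken of `Γ z` rather than `Γ(·,z)`; the two
agree off `z`. -/
theorem setLIntegral_mul_kernel (hΓ : L.IsFundamentalSolution Γ) (α : ℝ) {r : ℝ} (hr : 0 < r)
    {x z : EuclideanSpace ℝ (Fin n)} (hz : z ≠ x) :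
    ∫⁻ y in lBall Γ r x, ENNReal.ofReal (Γ z y * L.kernel Γ α x y) =
      ∫⁻ ρ in Ioc 0 r, ENNReal.ofReal (ρ ^ α * min (Γ x z) (1 / ρ)) := by
  rw [← setLIntegral_Ioi_rpow_mul_min hr]
  have ha : 0 < 1 / r := one_div_pos.2 hr
  have hg := hΓ.pos x z hz.symm
  set θ := powProfile α (1 / r)
  have hp := isProfile_powProfile α ha
  have hae : ∀ᵐ y, y ≠ x ∧ y ≠ z := (L.ae_ne x).and (L.ae_ne z)
  have hleft : Tendsto (fun k => ∫⁻ y, ENNReal.ofReal (Γ z y * L.levelDensity Γ x (θ k) y)) atTop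
      (𝓝 (∫⁻ y in lBall Γ r x, ENNReal.ofReal (Γ z y * L.kernel Γ α x y))) := by
    rw [← lintegral_indicator (hΓ.measurableSet_lBall r x)]
    refine lintegral_tendsto_of_tendsto_of_monotone
      (fun k => (hΓ.integrable_mul_levelDensity z x (hp k)).aemeasurable.ennreal_ofReal) ?_ ?_
    · filter_upwards [hae] with y hy k l hkl
      refine ENNReal.ofReal_le_ofReal (mul_le_mul_of_nonneg_left ?_ (hΓ.pos z y hy.2.symm).le)
      rw [levelDensity_of_ne hy.1, levelDensity_of_ne hy.1]
      exact mul_le_mul_of_nonneg_right (monotone_powProfile ha _ hkl) (L.energy_nonneg _ _)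
    · filter_upwards [hae] with y hy
      have h1 := ((tendsto_powProfile α (1 / r) (Γ x y)).mul_const
        (L.energy (Γ x) y)).const_mul (Γ z y)
      have h2 := (ENNReal.continuous_ofReal.tendsto _).comp h1
      simp only [levelDensity_of_ne hy.1]
      suffices e : (lBall Γ r x).indicator
          (fun y => ENNReal.ofReal (Γ z y * L.kernel Γ α x y)) y = ENNReal.ofReal (Γ z y *
            ((Ioi (1 / r)).indicator (fun s => s ^ (-(α + 2))) (Γ x y) * L.energy (Γ x) y)) by
        rw [e]
        exact h2
      by_cases hyr : 1 / r < Γ x y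
      · rw [indicator_of_mem (show y ∈ lBall Γ r x from Or.inr hyr),
          indicator_of_mem (show Γ x y ∈ Ioi (1 / r) from hyr), kernel_eq,
          Real.rpow_neg (hΓ.pos x y hy.1.symm).le, div_eq_inv_mul]
      · rw [indicator_of_notMem (show y ∉ lBall Γ r x from fun h => h.elim hy.1 hyr),
          indicator_of_notMem (show Γ x y ∉ Ioi (1 / r) from hyr)]
        simp
  have hθmin : ∀ k s, 0 ≤ θ k s * min (Γ x z) s := fun k s => by
    rcases le_or_gt s (1 / r) with hs | hs
    · simp only [θ, powProfile_of_le k hs, zero_mul, le_refl]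
    · exact mul_nonneg (powProfile_nonneg ha k s) (le_min hg.le (ha.trans hs).le)
  have hright : Tendsto (fun k => ∫⁻ s, ENNReal.ofReal (θ k s * min (Γ x z) s)) atTop
      (𝓝 (∫⁻ s in Ioi (1 / r), ENNReal.ofReal (s ^ (-(α + 2)) * min (Γ x z) s))) := by
    rw [← lintegral_indicator measurableSet_Ioi]
    refine lintegral_tendsto_of_tendsto_of_monotone
      (fun k => ((hp k).contDiff.continuous.mul
        (continuous_const.min continuous_id)).measurable.ennreal_ofReal.aemeasurable)
      (Eventually.of_forall fun s k l hkl => ?_) (Eventually.of_forall fun s => ?_)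
    · refine ENNReal.ofReal_le_ofReal ?_
      rcases le_or_gt s (1 / r) with hs | hs
      · simp only [θ, powProfile_of_le _ hs, zero_mul, le_refl]
      · exact mul_le_mul_of_nonneg_right (monotone_powProfile ha s hkl)
          (le_min hg.le (ha.trans hs).le)
    · have h2 := (ENNReal.continuous_ofReal.tendsto _).comp
        ((tendsto_powProfile α (1 / r) s).mul_const (min (Γ x z) s))
      suffices e : (Ioi (1 / r)).indicator
          (fun s => ENNReal.ofReal (s ^ (-(α + 2)) * min (Γ x z) s)) s = ENNReal.ofReal
            ((Ioi (1 / r)).indicator (fun s => s ^ (-(α + 2))) s * min (Γ x z) s) by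
        rw [e]
        exact h2
      by_cases hs : s ∈ Ioi (1 / r)
      · simp only [indicator_of_mem hs]
      · simp only [indicator_of_notMem hs, zero_mul, ENNReal.ofReal_zero]
  refine tendsto_nhds_unique hleft (hright.congr fun k => ?_)
  have hint : Integrable fun s => θ k s * min (Γ x z) s := by
    refine ((hp k).contDiff.continuous.mul
      (continuous_const.min continuous_id)).integrable_of_hasCompactSupport ?_
    exact HasCompactSupport.mul_right (HasCompactSupport.of_support_subset_isCompact
      (isCompact_Icc (a := 1 / r) (b := (k : ℝ)))
      ((hp k).support_subset.trans Ioo_subset_Icc_self))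
  rw [← ofReal_integral_eq_lintegral_ofReal hint (Eventually.of_forall (hθmin k)),
    ← ofReal_integral_eq_lintegral_ofReal (hΓ.integrable_mul_levelDensity z x (hp k)),
    hΓ.integral_mul_levelDensity hz (hp k)]
  filter_upwards [L.ae_ne z] with y hy
  exact mul_nonneg (hΓ.pos z y hy.symm).le (levelDensity_nonneg x y (powProfile_nonneg ha k))

end IsFundamentalSolution

end DivFormOperator

theorem integrableOn_rpow_Ioc {α r : ℝ} (hα : -1 < α) (hr : 0 < r) :
    IntegrableOn (fun ρ : ℝ => ρ ^ α) (Ioc 0 r) :=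
  (intervalIntegrable_iff_integrableOn_Ioc_of_le hr.le).1
    (intervalIntegral.intervalIntegrable_rpow' hα)

theorem setIntegral_rpow_Ioc {α r : ℝ} (hα : -1 < α) (hr : 0 < r) :
    ∫ ρ in Ioc 0 r, ρ ^ α = r ^ (α + 1) / (α + 1) := by
  rw [← intervalIntegral.integral_of_le hr.le, integral_rpow (Or.inl hα),
    Real.zero_rpow (by linarith), sub_zero]

theorem integrableOn_rpow_mul_min {α r g : ℝ} (hα : -1 < α) (hr : 0 < r) (hg : 0 ≤ g) :
    IntegrableOn (fun ρ : ℝ => ρ ^ α * min g (1 / ρ)) (Ioc 0 r) := by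
  refine ((integrableOn_rpow_Ioc hα hr).mul_const g).mono'
    (by fun_prop) ((ae_restrict_iff' measurableSet_Ioc).2 (Eventually.of_forall fun ρ hρ => ?_))
  have h1 := Real.rpow_nonneg hρ.1.le α
  rw [Real.norm_of_nonneg (mul_nonneg h1 (le_min hg (one_div_nonneg.2 hρ.1.le)))]
  exact mul_le_mul_of_nonneg_left (min_le_left _ _) h1

theorem setIntegral_rpow_mul_min_le {α r g : ℝ} (hα : -1 < α) (hr : 0 < r) (hg : 0 ≤ g) :
    ∫ ρ in Ioc 0 r, ρ ^ α * min g (1 / ρ) ≤ r ^ (α + 1) / (α + 1) * g := by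
  rw [← setIntegral_rpow_Ioc hα hr, ← integral_mul_const]
  exact setIntegral_mono_on (integrableOn_rpow_mul_min hα hr hg)
    ((integrableOn_rpow_Ioc hα hr).mul_const g) measurableSet_Ioc fun ρ hρ =>
    mul_le_mul_of_nonneg_left (min_le_left _ _) (Real.rpow_nonneg hρ.1.le α)

theorem setIntegral_rpow_mul_min_nonneg {α r g : ℝ} (hg : 0 ≤ g) :
    0 ≤ ∫ ρ in Ioc 0 r, ρ ^ α * min g (1 / ρ) :=
  setIntegral_nonneg measurableSet_Ioc fun _ hρ =>
    mul_nonneg (Real.rpow_nonneg hρ.1.le α) (le_min hg (one_div_nonneg.2 hρ.1.le))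

theorem setIntegral_rpow_mul_max {α r g : ℝ} (hα : -1 < α) (hr : 0 < r) (hg : 0 ≤ g) :
    ∫ ρ in Ioc 0 r, ρ ^ α * max (g - 1 / ρ) 0 =
      r ^ (α + 1) / (α + 1) * g - ∫ ρ in Ioc 0 r, ρ ^ α * min g (1 / ρ) := by
  rw [← setIntegral_rpow_Ioc hα hr, ← integral_mul_const,
    ← integral_sub ((integrableOn_rpow_Ioc hα hr).mul_const g)
      (integrableOn_rpow_mul_min hα hr hg)]
  refine integral_congr_ae (Eventually.of_forall fun ρ => ?_)
  simp only [← mul_sub]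
  rcases le_total g (1 / ρ) with h | h
  · rw [min_eq_left h, max_eq_right (by linarith), sub_self]
  · rw [min_eq_right h, max_eq_left (by linarith)]

namespace DivFormOperator

variable {n : ℕ} {L : DivFormOperator n}
  {Γ : EuclideanSpace ℝ (Fin n) → EuclideanSpace ℝ (Fin n) → ℝ}

namespace IsFundamentalSolution

theorem integrableOn_mul_kernel (hΓ : L.IsFundamentalSolution Γ) {α r : ℝ} (hα : -1 < α)
    (hr : 0 < r) {x z : EuclideanSpace ℝ (Fin n)} (hz : z ≠ x) :
    IntegrableOn (fun y => Γ y z * L.kernel Γ α x y) (lBall Γ r x) := by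
  have hae : ∀ᵐ y ∂(volume.restrict (lBall Γ r x)), y ≠ x ∧ y ≠ z :=
    ae_restrict_of_ae ((L.ae_ne x).and (L.ae_ne z))
  have hm : AEStronglyMeasurable (fun y => Γ z y * L.kernel Γ α x y)
      (volume.restrict (lBall Γ r x)) :=
    ((hΓ.aestronglyMeasurable z).mul (hΓ.aestronglyMeasurable_kernel α x)).restrict
  have h : IntegrableOn (fun y => Γ z y * L.kernel Γ α x y) (lBall Γ r x) := by
    refine (lintegral_ofReal_ne_top_iff_integrable hm ?_).1 ?_
    · filter_upwards [hae] with y hy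
      exact mul_nonneg (hΓ.pos z y hy.2.symm).le (hΓ.kernel_nonneg α hy.1)
    · rw [hΓ.setLIntegral_mul_kernel α hr hz]
      exact (integrableOn_rpow_mul_min hα hr (hΓ.pos x z hz.symm).le).lintegral_lt_top.ne
  refine h.congr ?_
  filter_upwards [hae] with y hy
  simp only [hΓ.symm z y hy.2.symm]

/-- The mean value formula for the fundamental solution with pole `z ≠ x`: up to the normalising
factor, its average over the `L`-ball is the integral of `ρ^α min (Γ(x,z)) (1/ρ)`. -/
theorem setIntegral_mul_kernel (hΓ : L.IsFundamentalSolution Γ) {α r : ℝ} (hα : -1 < α)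
    (hr : 0 < r) {x z : EuclideanSpace ℝ (Fin n)} (hz : z ≠ x) :
    ∫ y in lBall Γ r x, Γ y z * L.kernel Γ α x y =
      ∫ ρ in Ioc 0 r, ρ ^ α * min (Γ x z) (1 / ρ) := by
  have hg := (hΓ.pos x z hz.symm).le
  have hae : ∀ᵐ y ∂(volume.restrict (lBall Γ r x)), y ≠ x ∧ y ≠ z :=
    ae_restrict_of_ae ((L.ae_ne x).and (L.ae_ne z))
  have h0 : 0 ≤ᵐ[volume.restrict (lBall Γ r x)] fun y => Γ y z * L.kernel Γ α x y := by
    filter_upwards [hae] with y hy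
    exact mul_nonneg (hΓ.pos y z hy.2).le (hΓ.kernel_nonneg α hy.1)
  rw [integral_eq_lintegral_of_nonneg_ae h0
      (hΓ.integrableOn_mul_kernel hα hr hz).aestronglyMeasurable,
    integral_eq_lintegral_of_nonneg_ae _ (integrableOn_rpow_mul_min hα hr hg).aestronglyMeasurable,
    ← hΓ.setLIntegral_mul_kernel α hr hz]
  · congr 1
    refine lintegral_congr_ae ?_
    filter_upwards [hae] with y hy
    simp only [hΓ.symm z y hy.2.symm]
  · exact (ae_restrict_iff' measurableSet_Ioc).2 (Eventually.of_forall fun ρ hρ =>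
      mul_nonneg (Real.rpow_nonneg hρ.1.le α) (le_min hg (one_div_nonneg.2 hρ.1.le)))

end IsFundamentalSolution

end DivFormOperator

/-! ### Averages of potentials -/

namespace DivFormOperator

variable {n : ℕ} {L : DivFormOperator n}
  {Γ : EuclideanSpace ℝ (Fin n) → EuclideanSpace ℝ (Fin n) → ℝ}

namespace IsFundamentalSolution

theorem integrable_mul_mul_kernel_prod (hΓ : L.IsFundamentalSolution Γ) {α r : ℝ} (hα : -1 < α)
    (hr : 0 < r) (x : EuclideanSpace ℝ (Fin n)) {f : EuclideanSpace ℝ (Fin n) → ℝ}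
    (hf : Continuous f) (hfc : HasCompactSupport f) :
    Integrable (fun p : EuclideanSpace ℝ (Fin n) × EuclideanSpace ℝ (Fin n) =>
      Γ p.1 p.2 * f p.2 * L.kernel Γ α x p.1) ((volume.restrict (lBall Γ r x)).prod volume) := by
  have hm : AEStronglyMeasurable (fun p : EuclideanSpace ℝ (Fin n) × EuclideanSpace ℝ (Fin n) =>
      Γ p.1 p.2 * f p.2 * L.kernel Γ α x p.1) ((volume.restrict (lBall Γ r x)).prod volume) :=
    ((hΓ.aestronglyMeasurable_uncurry.mono_ac
      (Measure.restrict_le_self.absolutelyContinuous.prod .rfl)).mul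
      (hf.comp continuous_snd).aestronglyMeasurable).mul
      (hΓ.aestronglyMeasurable_kernel α x).restrict.comp_fst
  refine (integrable_prod_iff' hm).2 ⟨?_, ?_⟩
  · filter_upwards [L.ae_ne x] with z hz
    refine ((hΓ.integrableOn_mul_kernel hα hr hz).const_mul (f z)).congr
      (Eventually.of_forall fun y => ?_)
    simp only
    ring
  · refine ((hΓ.integrable_mul x hf hfc).norm.const_mul (r ^ (α + 1) / (α + 1))).mono'
      hm.norm.prod_swap.integral_prod_right' ?_
    filter_upwards [L.ae_ne x] with z hz
    have h0 : ∫ y in lBall Γ r x, ‖Γ y z * f z * L.kernel Γ α x y‖ =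
        ‖f z‖ * ∫ ρ in Ioc 0 r, ρ ^ α * min (Γ x z) (1 / ρ) := by
      rw [← hΓ.setIntegral_mul_kernel hα hr hz, ← integral_const_mul]
      refine integral_congr_ae ?_
      filter_upwards [ae_restrict_of_ae ((L.ae_ne x).and (L.ae_ne z))] with y hy
      rw [norm_mul, norm_mul, Real.norm_of_nonneg (hΓ.pos y z hy.2).le,
        Real.norm_of_nonneg (hΓ.kernel_nonneg α hy.1)]
      ring
    have hg := (hΓ.pos x z hz.symm).le
    rw [h0, norm_mul, norm_norm, Real.norm_of_nonneg (setIntegral_rpow_mul_min_nonneg hg),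
      norm_mul, Real.norm_of_nonneg hg]
    calc ‖f z‖ * ∫ ρ in Ioc 0 r, ρ ^ α * min (Γ x z) (1 / ρ)
        ≤ ‖f z‖ * (r ^ (α + 1) / (α + 1) * Γ x z) :=
          mul_le_mul_of_nonneg_left (setIntegral_rpow_mul_min_le hα hr hg) (norm_nonneg _)
      _ = _ := by ring

theorem integrableOn_potential_mul_kernel (hΓ : L.IsFundamentalSolution Γ) {α r : ℝ}
    (hα : -1 < α) (hr : 0 < r) (x : EuclideanSpace ℝ (Fin n))
    {f : EuclideanSpace ℝ (Fin n) → ℝ} (hf : Continuous f) (hfc : HasCompactSupport f) :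
    IntegrableOn (fun y => potential Γ f y * L.kernel Γ α x y) (lBall Γ r x) := by
  have h := (hΓ.integrable_mul_mul_kernel_prod hα hr x hf hfc).integral_prod_left
  simp only [integral_mul_const] at h
  exact h

theorem setIntegral_potential_mul_kernel (hΓ : L.IsFundamentalSolution Γ) {α r : ℝ}
    (hα : -1 < α) (hr : 0 < r) (x : EuclideanSpace ℝ (Fin n))
    {f : EuclideanSpace ℝ (Fin n) → ℝ} (hf : Continuous f) (hfc : HasCompactSupport f) :
    ∫ y in lBall Γ r x, potential Γ f y * L.kernel Γ α x y =
      ∫ z, f z * ∫ ρ in Ioc 0 r, ρ ^ α * min (Γ x z) (1 / ρ) := by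
  have h := integral_integral_swap (f := fun y z => Γ y z * f z * L.kernel Γ α x y)
    (hΓ.integrable_mul_mul_kernel_prod hα hr x hf hfc)
  simp only [integral_mul_const] at h
  refine h.trans (integral_congr_ae ?_)
  filter_upwards [L.ae_ne x] with z hz
  rw [← hΓ.setIntegral_mul_kernel hα hr hz, ← integral_const_mul]
  refine integral_congr_ae (Eventually.of_forall fun y => ?_)
  simp only
  ring

/-- The integrability behind Fubini's theorem for `N_r(w)`. The set `s` is the whole space for
compactly supported `w`, and `Ω_r(x)` for `w = 1`. -/
theorem integrable_rpow_mul_max_mul_prod (hΓ : L.IsFundamentalSolution Γ) {α r : ℝ}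
    (hα : -1 < α) (hr : 0 < r) (x : EuclideanSpace ℝ (Fin n))
    {w : EuclideanSpace ℝ (Fin n) → ℝ} (hw : Continuous w) {s : Set (EuclideanSpace ℝ (Fin n))}
    (hs : IntegrableOn (fun y => Γ x y * w y) s) :
    Integrable (fun p : ℝ × EuclideanSpace ℝ (Fin n) =>
      p.1 ^ α * (max (Γ x p.2 - 1 / p.1) 0 * w p.2))
      ((volume.restrict (Ioc 0 r)).prod (volume.restrict s)) := by
  refine ((integrableOn_rpow_Ioc hα hr).mul_prod hs).mono ?_ ?_
  · have h1 : AEStronglyMeasurable (fun p : ℝ × EuclideanSpace ℝ (Fin n) => Γ x p.2)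
        ((volume.restrict (Ioc 0 r)).prod (volume.restrict s)) :=
      (hΓ.aestronglyMeasurable x).restrict.comp_snd
    have h2 : AEStronglyMeasurable (fun p : ℝ × EuclideanSpace ℝ (Fin n) => w p.2)
        ((volume.restrict (Ioc 0 r)).prod (volume.restrict s)) :=
      (hw.comp continuous_snd).aestronglyMeasurable
    have h3 : Measurable fun p : ℝ × EuclideanSpace ℝ (Fin n) => 1 / p.1 := by fun_prop
    have h4 : Measurable fun p : ℝ × EuclideanSpace ℝ (Fin n) => p.1 ^ α := by fun_prop
    exact h4.aestronglyMeasurable.mul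
      (((h1.sub h3.aestronglyMeasurable).sup aestronglyMeasurable_const).mul h2)
  · have hρ : ∀ᵐ p ∂((volume.restrict (Ioc (0 : ℝ) r)).prod (volume.restrict s)),
        p.1 ∈ Ioc (0 : ℝ) r :=
      Measure.quasiMeasurePreserving_fst.ae (ae_restrict_mem measurableSet_Ioc)
    have hx : ∀ᵐ p ∂((volume.restrict (Ioc (0 : ℝ) r)).prod (volume.restrict s)), p.2 ≠ x :=
      Measure.quasiMeasurePreserving_snd.ae (ae_restrict_of_ae (L.ae_ne x))
    filter_upwards [hρ, hx] with p hp hpx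
    have hg := (hΓ.pos x p.2 hpx.symm).le
    simp only [norm_mul]
    refine mul_le_mul_of_nonneg_left (mul_le_mul_of_nonneg_right ?_ (norm_nonneg _))
      (norm_nonneg _)
    rw [Real.norm_of_nonneg hg, Real.norm_of_nonneg (le_max_right _ _)]
    exact max_le (sub_le_self _ (one_div_nonneg.2 hp.1.le)) hg

/-- On `Ω_ρ(x)` the function `Γ x - 1/ρ` agrees almost everywhere with its positive part, which
vanishes off `Ω_ρ(x)`. -/
theorem setIntegral_lBall (hΓ : L.IsFundamentalSolution Γ) {ρ : ℝ}
    (x : EuclideanSpace ℝ (Fin n)) (w : EuclideanSpace ℝ (Fin n) → ℝ)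
    {s : Set (EuclideanSpace ℝ (Fin n))} (hsm : MeasurableSet s) (hs : lBall Γ ρ x ⊆ s) :
    ∫ y in lBall Γ ρ x, (Γ x y - 1 / ρ) * w y = ∫ y in s, max (Γ x y - 1 / ρ) 0 * w y := by
  have h1 : ∫ y in lBall Γ ρ x, (Γ x y - 1 / ρ) * w y =
      ∫ y in lBall Γ ρ x, max (Γ x y - 1 / ρ) 0 * w y := by
    refine setIntegral_congr_ae (hΓ.measurableSet_lBall ρ x) ?_
    filter_upwards [L.ae_ne x] with y hy hyB
    have : 1 / ρ < Γ x y := hyB.resolve_left hy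
    rw [max_eq_left (by linarith)]
  rw [h1]
  refine (setIntegral_eq_of_subset_of_forall_sdiff_eq_zero hsm hs fun y hy => ?_).symm
  have : ¬1 / ρ < Γ x y := fun h => hy.2 (Or.inr h)
  rw [max_eq_right (by linarith), zero_mul]

theorem lBall_subset_lBall {ρ r : ℝ} (hρ : 0 < ρ) (h : ρ ≤ r) (x : EuclideanSpace ℝ (Fin n)) :
    lBall Γ ρ x ⊆ lBall Γ r x := fun _ hy =>
  hy.imp_right fun h' => (one_div_le_one_div_of_le hρ h).trans_lt h'

theorem intervalIntegrable_avgN (hΓ : L.IsFundamentalSolution Γ) {α r : ℝ}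
    (hα : -1 < α) (hr : 0 < r) (x : EuclideanSpace ℝ (Fin n))
    {w : EuclideanSpace ℝ (Fin n) → ℝ} (hw : Continuous w)
    (hs : IntegrableOn (fun y => Γ x y * w y) (lBall Γ r x)) :
    IntervalIntegrable (fun ρ => ρ ^ α * ∫ y in lBall Γ ρ x, (Γ x y - 1 / ρ) * w y)
      volume 0 r := by
  rw [intervalIntegrable_iff_integrableOn_Ioc_of_le hr.le]
  have h := (hΓ.integrable_rpow_mul_max_mul_prod hα hr x hw hs).integral_prod_left
  simp only [integral_const_mul] at h
  refine h.congr ((ae_restrict_iff' measurableSet_Ioc).2 (Eventually.of_forall fun ρ hρ => ?_))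
  simp only
  rw [hΓ.setIntegral_lBall x w (hΓ.measurableSet_lBall r x) (lBall_subset_lBall hρ.1 hρ.2 x)]

/-- The potential satisfies `M_r(u_f)(x) - u_f(x) = -N_r(f)(x)`. -/
theorem avgM_potential_sub (hΓ : L.IsFundamentalSolution Γ) {α r : ℝ}
    (hα : -1 < α) (hr : 0 < r) (x : EuclideanSpace ℝ (Fin n))
    {f : EuclideanSpace ℝ (Fin n) → ℝ} (hf : Continuous f) (hfc : HasCompactSupport f) :
    L.avgM Γ α r (potential Γ f) x - potential Γ f x = -avgN Γ α r f x := by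
  have hint : IntegrableOn (fun y => Γ x y * f y) univ := (hΓ.integrable_mul x hf hfc).integrableOn
  have hprod := hΓ.integrable_rpow_mul_max_mul_prod hα hr x hf hint
  have hN : ∫ ρ in (0 : ℝ)..r, ρ ^ α * ∫ y in lBall Γ ρ x, (Γ x y - 1 / ρ) * f y =
      ∫ y, f y * ∫ ρ in Ioc 0 r, ρ ^ α * max (Γ x y - 1 / ρ) 0 := by
    rw [intervalIntegral.integral_of_le hr.le]
    have h := integral_integral_swap
      (f := fun ρ y => ρ ^ α * (max (Γ x y - 1 / ρ) 0 * f y)) hprod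
    simp only [integral_const_mul, Measure.restrict_univ] at h
    calc _ = ∫ ρ in Ioc 0 r, ρ ^ α * ∫ y, max (Γ x y - 1 / ρ) 0 * f y := by
          refine setIntegral_congr_fun measurableSet_Ioc fun ρ _ => ?_
          rw [hΓ.setIntegral_lBall x f .univ (subset_univ _), Measure.restrict_univ]
      _ = _ := by
          rw [h]
          refine integral_congr_ae (Eventually.of_forall fun y => ?_)
          simp only [← integral_const_mul]
          refine integral_congr_ae (Eventually.of_forall fun ρ => ?_)
          simp only
          ring
  have hJ : Integrable fun y => f y * ∫ ρ in Ioc 0 r, ρ ^ α * max (Γ x y - 1 / ρ) 0 := by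
    have h := hprod.integral_prod_right
    rw [Measure.restrict_univ] at h
    refine h.congr (Eventually.of_forall fun y => ?_)
    simp only [← integral_const_mul]
    refine integral_congr_ae (Eventually.of_forall fun ρ => ?_)
    simp only
    ring
  have hM : ∫ y in lBall Γ r x, potential Γ f y * L.kernel Γ α x y =
      r ^ (α + 1) / (α + 1) * potential Γ f x -
        ∫ y, f y * ∫ ρ in Ioc 0 r, ρ ^ α * max (Γ x y - 1 / ρ) 0 := by
    rw [hΓ.setIntegral_potential_mul_kernel hα hr x hf hfc, potential, ← integral_const_mul,
      ← integral_sub ((hΓ.integrable_mul x hf hfc).const_mul _) hJ]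
    refine integral_congr_ae ?_
    filter_upwards [L.ae_ne x] with z hz
    rw [setIntegral_rpow_mul_max hα hr (hΓ.pos x z hz.symm).le]
    ring
  have h1 : α + 1 ≠ 0 := by linarith
  have h2 : r ^ (α + 1) ≠ 0 := (Real.rpow_pos_of_pos hr _).ne'
  rw [avgM, avgN, hM, hN]
  field_simp
  ring

theorem integrableOn_lBall (hΓ : L.IsFundamentalSolution Γ) {r : ℝ} (hr : 0 < r)
    (x : EuclideanSpace ℝ (Fin n)) : IntegrableOn (Γ x) (lBall Γ r x) := by
  obtain ⟨K, hK, hsub⟩ := mem_cocompact.1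
    ((hΓ.tendsto_cocompact x).eventually (gt_mem_nhds (one_div_pos.2 hr)))
  refine ((hΓ.locallyIntegrable x).integrableOn_isCompact
    (hK.union (isCompact_singleton (x := x)))).mono_set fun y hy => ?_
  by_contra hyK
  rw [mem_union, not_or] at hyK
  have h1 : Γ x y < 1 / r := hsub hyK.1
  exact (hy.resolve_left hyK.2).not_gt h1

end IsFundamentalSolution

end DivFormOperator

/-! ### The limit as the `L`-balls shrink -/

namespace DivFormOperator

variable {n : ℕ} {L : DivFormOperator n}
  {Γ : EuclideanSpace ℝ (Fin n) → EuclideanSpace ℝ (Fin n) → ℝ}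

namespace IsFundamentalSolution

theorem integrableOn_lBall_sub (hΓ : L.IsFundamentalSolution Γ) {ρ : ℝ} (hρ : 0 < ρ)
    (x : EuclideanSpace ℝ (Fin n)) : IntegrableOn (fun y => Γ x y - 1 / ρ) (lBall Γ ρ x) := by
  refine Integrable.mono (hΓ.integrableOn_lBall hρ x)
    ((hΓ.aestronglyMeasurable x).restrict.sub aestronglyMeasurable_const) ?_
  filter_upwards [ae_restrict_of_ae (L.ae_ne x),
    ae_restrict_mem (hΓ.measurableSet_lBall ρ x)] with y hy hyB
  have h1 : 1 / ρ < Γ x y := hyB.resolve_left hy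
  have h2 := one_div_pos.2 hρ
  rw [Real.norm_of_nonneg (by linarith), Real.norm_of_nonneg (by linarith)]
  linarith

theorem setIntegral_lBall_pos (hΓ : L.IsFundamentalSolution Γ) {ρ : ℝ} (hρ : 0 < ρ)
    (x : EuclideanSpace ℝ (Fin n)) : 0 < ∫ y in lBall Γ ρ x, (Γ x y - 1 / ρ) := by
  have hpos : ∀ y ∈ lBall Γ ρ x, y ≠ x → 0 < Γ x y - 1 / ρ := fun y hyB hy =>
    sub_pos.2 (hyB.resolve_left hy)
  rw [setIntegral_pos_iff_support_of_nonneg_ae _ (hΓ.integrableOn_lBall_sub hρ x)]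
  · refine ((hΓ.isOpen_lBall ρ x).measure_pos volume ⟨x, Or.inl rfl⟩).trans_le ?_
    refine measure_mono_ae ?_
    filter_upwards [L.ae_ne x] with y hy hyB
    exact ⟨(hpos y hyB hy).ne', hyB⟩
  · filter_upwards [ae_restrict_of_ae (L.ae_ne x),
      ae_restrict_mem (hΓ.measurableSet_lBall ρ x)] with y hy hyB
    exact (hpos y hyB hy).le

theorem intervalIntegrable_avgQ (hΓ : L.IsFundamentalSolution Γ) {α r : ℝ} (hα : -1 < α)
    (hr : 0 < r) (x : EuclideanSpace ℝ (Fin n)) :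
    IntervalIntegrable (fun ρ => ρ ^ α * ∫ y in lBall Γ ρ x, (Γ x y - 1 / ρ)) volume 0 r := by
  have h := hΓ.intervalIntegrable_avgN hα hr x (w := fun _ => 1) continuous_const
    (by simpa using hΓ.integrableOn_lBall hr x)
  simpa using h

theorem avgQ_pos (hΓ : L.IsFundamentalSolution Γ) {α r : ℝ} (hα : -1 < α) (hr : 0 < r)
    (x : EuclideanSpace ℝ (Fin n)) : 0 < avgQ Γ α r x := by
  have h1 : 0 < (α + 1) / r ^ (α + 1) :=
    div_pos (by linarith) (Real.rpow_pos_of_pos hr _)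
  simp only [avgQ, avgN, mul_one]
  refine mul_pos h1 (intervalIntegral.intervalIntegral_pos_of_pos_on
    (hΓ.intervalIntegrable_avgQ hα hr x) (fun ρ hρ => ?_) hr)
  exact mul_pos (Real.rpow_pos_of_pos hρ.1 _) (hΓ.setIntegral_lBall_pos hρ.1 x)

/-- If `w` oscillates by at most `ε` on `Ω_r(x)`, then `N_r(w)(x)` is within `ε Q_r(x)` of
`w(x) Q_r(x)`. -/
theorem abs_avgN_sub_le (hΓ : L.IsFundamentalSolution Γ) {α r : ℝ} (hα : -1 < α) (hr : 0 < r)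
    {x : EuclideanSpace ℝ (Fin n)} {w : EuclideanSpace ℝ (Fin n) → ℝ} (hw : Continuous w)
    (hint : ∀ ρ > 0, IntegrableOn (fun y => Γ x y * w y) (lBall Γ ρ x)) {ε : ℝ}
    (hε : ∀ y ∈ lBall Γ r x, |w y - w x| ≤ ε) :
    |avgN Γ α r w x - w x * avgQ Γ α r x| ≤ ε * avgQ Γ α r x := by
  have h1 : 0 < (α + 1) / r ^ (α + 1) :=
    div_pos (by linarith) (Real.rpow_pos_of_pos hr _)
  have hN := hΓ.intervalIntegrable_avgN hα hr x hw (hint r hr)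
  have hQ := hΓ.intervalIntegrable_avgQ hα hr x
  have e1 : avgN Γ α r w x - w x * avgQ Γ α r x = (α + 1) / r ^ (α + 1) *
      ∫ ρ in (0 : ℝ)..r, (ρ ^ α * (∫ y in lBall Γ ρ x, (Γ x y - 1 / ρ) * w y) -
        w x * (ρ ^ α * ∫ y in lBall Γ ρ x, (Γ x y - 1 / ρ))) := by
    rw [intervalIntegral.integral_sub hN (hQ.const_mul _), intervalIntegral.integral_const_mul]
    simp only [avgQ, avgN, mul_one]
    ring
  have e2 : ε * avgQ Γ α r x = (α + 1) / r ^ (α + 1) *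
      ∫ ρ in (0 : ℝ)..r, ε * (ρ ^ α * ∫ y in lBall Γ ρ x, (Γ x y - 1 / ρ)) := by
    rw [intervalIntegral.integral_const_mul]
    simp only [avgQ, avgN, mul_one]
    ring
  rw [e1, e2, abs_mul, abs_of_pos h1]
  refine mul_le_mul_of_nonneg_left ?_ h1.le
  rw [← Real.norm_eq_abs]
  refine intervalIntegral.norm_integral_le_of_norm_le hr.le
    (Eventually.of_forall fun ρ hρ => ?_) (hQ.const_mul ε)
  have hsub := hΓ.integrableOn_lBall_sub hρ.1 x
  have hsubw : IntegrableOn (fun y => (Γ x y - 1 / ρ) * (w y - w x)) (lBall Γ ρ x) := by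
    refine (hsub.norm.const_mul ε).mono'
      (hsub.aestronglyMeasurable.mul (hw.sub continuous_const).aestronglyMeasurable) ?_
    filter_upwards [ae_restrict_mem (hΓ.measurableSet_lBall ρ x)] with y hy
    rw [norm_mul, mul_comm]
    exact mul_le_mul_of_nonneg_right (hε y (lBall_subset_lBall hρ.1 hρ.2 x hy)) (norm_nonneg _)
  have e3 : ∫ y in lBall Γ ρ x, (Γ x y - 1 / ρ) * w y =
      (∫ y in lBall Γ ρ x, (Γ x y - 1 / ρ) * (w y - w x)) +
        w x * ∫ y in lBall Γ ρ x, (Γ x y - 1 / ρ) := by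
    rw [← integral_const_mul, ← integral_add hsubw (hsub.const_mul _)]
    refine integral_congr_ae (Eventually.of_forall fun y => ?_)
    simp only
    ring
  have e4 : ‖∫ y in lBall Γ ρ x, (Γ x y - 1 / ρ) * (w y - w x)‖ ≤
      ε * ∫ y in lBall Γ ρ x, (Γ x y - 1 / ρ) := by
    rw [← integral_const_mul]
    refine norm_integral_le_of_norm_le (hsub.const_mul ε) ?_
    filter_upwards [ae_restrict_of_ae (L.ae_ne x),
      ae_restrict_mem (hΓ.measurableSet_lBall ρ x)] with y hy hyB
    have h0 : 0 ≤ Γ x y - 1 / ρ := (sub_pos.2 (hyB.resolve_left hy)).le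
    rw [norm_mul, Real.norm_of_nonneg h0, mul_comm]
    exact mul_le_mul_of_nonneg_right (hε y (lBall_subset_lBall hρ.1 hρ.2 x hyB)) h0
  have hρα := Real.rpow_nonneg hρ.1.le α
  rw [e3]
  calc _ = ρ ^ α * ‖∫ y in lBall Γ ρ x, (Γ x y - 1 / ρ) * (w y - w x)‖ := by
        rw [← Real.norm_of_nonneg hρα, ← norm_mul, Real.norm_of_nonneg hρα]
        congr 1
        ring
    _ ≤ ρ ^ α * (ε * ∫ y in lBall Γ ρ x, (Γ x y - 1 / ρ)) := mul_le_mul_of_nonneg_left e4 hρα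
    _ = _ := by ring

theorem tendsto_asympQuotient_potential (hΓ : L.IsFundamentalSolution Γ) {α : ℝ} (hα : -1 < α)
    {f : EuclideanSpace ℝ (Fin n) → ℝ} (hf : Continuous f) (hfc : HasCompactSupport f)
    (x : EuclideanSpace ℝ (Fin n)) :
    Tendsto (L.asympQuotient Γ α (potential Γ f) x) (𝓝[>] 0) (𝓝 (-f x)) := by
  refine Metric.nhds_basis_closedBall.tendsto_right_iff.2 fun ε hε => ?_
  obtain ⟨δ, hδ, hball⟩ := Metric.continuousAt_iff.1 hf.continuousAt ε hε
  obtain ⟨T, hT, hTle⟩ := hΓ.exists_le_of_notMem_ball x hδ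
  filter_upwards [Ioo_mem_nhdsGT (one_div_pos.2 hT)] with r hr
  have hsub : ∀ y ∈ lBall Γ r x, |f y - f x| ≤ ε := by
    intro y hy
    suffices hyb : y ∈ Metric.ball x δ from (hball hyb).le
    by_contra hyb
    have hyx : y ≠ x := by
      rintro rfl
      exact hyb (Metric.mem_ball_self hδ)
    have h1 : 1 / r < Γ x y := hy.resolve_left hyx
    have h2 : T < 1 / r := (lt_one_div hT hr.1).2 hr.2
    linarith [hTle y hyb]
  have hQ := hΓ.avgQ_pos hα hr.1 x
  have h := hΓ.abs_avgN_sub_le hα hr.1 hf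
    (fun ρ _ => (hΓ.integrable_mul x hf hfc).integrableOn) hsub
  rw [Metric.mem_closedBall, Real.dist_eq, asympQuotient, hΓ.avgM_potential_sub hα hr.1 x hf hfc,
    show -avgN Γ α r f x / avgQ Γ α r x - -f x =
      -((avgN Γ α r f x - f x * avgQ Γ α r x) / avgQ Γ α r x) by field_simp; ring,
    abs_neg, abs_div, abs_of_pos hQ, div_le_iff₀ hQ]
  exact h

end IsFundamentalSolution

end DivFormOperator

/-- The first two conjuncts say that the integrals and quotients in the conclusion are genuine:
the potential and `M_r(u_f)` are given by absolutely convergent integrals, and `Q_r(x) > 0`. -/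
theorem theorem1p4 {n : ℕ} (L : DivFormOperator n) (hL : L.IsHypoelliptic)
    (Γ : EuclideanSpace ℝ (Fin n) → EuclideanSpace ℝ (Fin n) → ℝ)
    (hΓ : L.IsFundamentalSolution Γ) (α : ℝ) (hα : -1 < α)
    (f : EuclideanSpace ℝ (Fin n) → ℝ) (hf : Continuous f) (hfc : HasCompactSupport f) :
    (∀ x, Integrable (fun y => Γ x y * f y)) ∧
    (∀ x, ∀ r : ℝ, 0 < r →
      IntegrableOn (fun y => potential Γ f y * L.kernel Γ α x y)
        (DivFormOperator.lBall Γ r x) ∧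
      0 < DivFormOperator.avgQ Γ α r x) ∧
    potential Γ f ∈ L.asympClass Γ α univ ∧
    ∀ x, L.asympOp Γ α (potential Γ f) x = -f x := by
  refine ⟨fun x => hΓ.integrable_mul x hf hfc, fun x r hr =>
    ⟨hΓ.integrableOn_potential_mul_kernel hα hr x hf hfc, hΓ.avgQ_pos hα hr x⟩,
    ⟨(hΓ.continuous_potential hf hfc).continuousOn, fun x _ =>
      ⟨-f x, hΓ.tendsto_asympQuotient_potential hα hf hfc x⟩⟩,
    fun x => (hΓ.tendsto_asympQuotient_potential hα hf hfc x).limUnder_eq⟩
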